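/- Let $0<a<b<2a$ and let $U:\mathbb R\to\mathbb R$ be a pair potential such that (U0) $U$ is continuous and even; (U1) $U(y)=0$ for $|y|\ge b$, and $U\in C^3((0,b))$, with finite left limits at $b$ of $U$ and of its derivatives up to order three (i.e. $U|_{(0,b]}$ has a $C^3$ extension to $(0,\infty)$); (U2) $U(a)=\min_{y\ge 0}U(y)$; (U3) there are $a_0\in(0,a)$ and $u_0>0$ with $U''(y)\ge u_0$ for all $y\in(a_0,b)$. For $\varepsilon,\sigma>0$ put $H(x,t)=U(x)+U(2a(1+t)-x)$ and let $x_t$, $x_0=a$, be a continuous process solving $$dx_t=-\frac1\varepsilon\,\frac{\partial H}{\partial x}(x_t,t)\,dt+\frac{\sigma}{\sqrt\varepsilon}\,dW_t$$ up to the time $\tau=\inf\{t\ge 0: x_t\notin(2a(1+t)-b,\,b)\}$, where $W$ is a standard Brownian motion. (This is a Brownian particle between a particle fixed at $0$ and a particle pulled away at slow speed, in rescaled time; the chain breaks on the left if $x_\tau=b$.) Write $f(\sigma)\ll g(\sigma)$ if $f(\sigma)/g(\sigma)\to0$ as $\sigma\downarrow0$, and let $\varepsilon=\varepsilon(\sigma)>0$.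 1. (Fast stretching) If $\sigma|\ln\sigma|^{1/2}\ll\varepsilon(\sigma)\ll1$, then $\mathbb P\{x_\tau=b\}\to0$ as $\sigma\downarrow0$. 2. (Slow stretching) If $\sigma^{-2/3}\exp\{-\sigma^{-2/3}\}\ll\varepsilon(\sigma)\ll\sigma|\ln\sigma|^{-1/2}$, then $\mathbb P\{x_\tau=b\}\to\frac12$ as $\sigma\downarrow0$. Equivalent version for the deviation process. Let $\tilde U:\mathbb R\to\mathbb R$ be continuous and even, $C^3$ on $(0,\infty)$, equal to $U$ on $[-b,b]$, with $\tilde U''$ bounded below by a positive constant on $\{|y|>a_0\}$. For all sufficiently small $\sigma$ let $x^{\rm det}$ with $x_0^{\rm det}=a$ solve $dx_t^{\rm det}=\frac1\varepsilon\big(-\tilde U'(x_t^{\rm det})+\tilde U'(2a(1+t)-x_t^{\rm det})\big)dt$ on $[0,b/a-1]$, with $0<x^{\rm det}_t<2a(1+t)$. Put $d_+(t)=b-x_t^{\rm det}$, $d_-(t)=2a(1+t)-b-x_t^{\rm det}$ and $\mathcal D=\{(y,t): d_-(t)<y<d_+(t),\ 0\le t\le b/a-1\}$. Let $y_t$ be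 a continuous process with $y_0=0$ that solves, up to $\tau=\inf\{t\ge0:(y_t,t)\notin\mathcal D\}$, $$dy_t=\frac1\varepsilon\Big[-\tilde U'(x_t^{\rm det}+y_t)+\tilde U'(x_t^{\rm det})+\tilde U'(2a(1+t)-x_t^{\rm det}-y_t)-\tilde U'(2a(1+t)-x_t^{\rm det})\Big]dt+\frac{\sigma}{\sqrt\varepsilon}\,dW_t .$$ Then $\mathbb P\{y_\tau=d_+(\tau)\}\to0$ as $\sigma\downarrow0$ in the situation of 1, and $\mathbb P\{y_\tau=d_+(\tau)\}\to\frac12$ in the situation of 2. -/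

import Mathlib

open Filter Topology MeasureTheory ProbabilityTheory
open scoped NNReal

noncomputable section

namespace BreakingChain

/-- `f(σ) ≪ g(σ)`: the quotient `f(σ)/g(σ)` tends to `0` as `σ ↓ 0`. -/
def MuchLess (f g : ℝ → ℝ) : Prop :=
  Tendsto (fun σ => f σ / g σ) (𝓝[>] 0) (𝓝 0)

/-- Fast stretching: `σ |ln σ|^{1/2} ≪ ε(σ) ≪ 1`. -/
def FastStretching (ε : ℝ → ℝ) : Prop :=
  MuchLess (fun σ => σ * |Real.log σ| ^ (1 / 2 : ℝ)) ε ∧ MuchLess ε (fun _ => 1)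

/-- Slow stretching: `σ^{-2/3} exp(-σ^{-2/3}) ≪ ε(σ) ≪ σ |ln σ|^{-1/2}`. -/
def SlowStretching (ε : ℝ → ℝ) : Prop :=
  MuchLess (fun σ => 1 / σ ^ (2 / 3 : ℝ) * Real.exp (-(1 / σ ^ (2 / 3 : ℝ)))) ε ∧
    MuchLess ε (fun σ => σ * |Real.log σ| ^ (-(1 / 2) : ℝ))

/-- The assumptions on the cut-off pair potential `U`, of range `b` and with optimal distance `a`.
`ContDiffOn` on the half-open interval `(0, b]` means that `U` is of class `C³` on `(0, b)` and that
it and its derivatives up to the third have finite left limits at `b`, i.e. that the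
restriction of `U` to `(0, b]` has an extension of class `C³` to `(0, ∞)`. -/
structure IsChainPotential (U : ℝ → ℝ) (a b a₀ u₀ : ℝ) : Prop where
  a_pos : 0 < a
  a_lt_b : a < b
  b_lt : b < 2 * a
  continuous : Continuous U
  even : ∀ y, U (-y) = U y
  eq_zero : ∀ y, b ≤ |y| → U y = 0
  contDiffOn : ContDiffOn ℝ 3 U (Set.Ioc 0 b)
  min : ∀ y, 0 ≤ y → U a ≤ U y
  a₀_mem : a₀ ∈ Set.Ioo 0 a
  u₀_pos : 0 < u₀
  convex : ∀ y ∈ Set.Ioo a₀ b, u₀ ≤ deriv (deriv U) y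

/-- The potential energy `H(x, t) = U(x) + U(2a(1+t) - x)` of the middle particle. -/
def energy (U : ℝ → ℝ) (a x t : ℝ) : ℝ := U x + U (2 * a * (1 + t) - x)

/-- The partial derivative `∂H/∂x (x, t)`. -/
def energyDeriv (U : ℝ → ℝ) (a x t : ℝ) : ℝ := deriv (fun z => energy U a z t) x

/-- The time at which the chain breaks along the path `x`:
`τ = inf {t ≥ 0 : x_t ∉ (2a(1+t) - b, b)}`. The set contains `b/a - 1`. -/
def breakTime (a b : ℝ) (x : ℝ≥0 → ℝ) : ℝ≥0 :=
  sInf {t : ℝ≥0 | x t ∉ Set.Ioo (2 * a * (1 + (t : ℝ)) - b) b}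

/-- `X` has continuous paths, starts at `a`, and solves
`dx_t = -(1/ε) ∂H/∂x (x_t, t) dt + (σ/√ε) dW_t` up to the time at which the chain breaks, where
`W` is a standard Brownian motion. The noise is additive, so that the stochastic
integral of its coefficient is `(σ/√ε) W_t` and the equation is an integral equation for
almost every path. -/
structure SolvesChainSDE {Ω : Type*} [MeasurableSpace Ω] (P : Measure Ω)
    (U : ℝ → ℝ) (a b ε σ : ℝ) (W X : ℝ≥0 → Ω → ℝ) : Prop where
  brownian : IsBrownianReal W P
  continuous : ∀ᵐ ω ∂P, Continuous (fun t => X t ω)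
  init : ∀ᵐ ω ∂P, X 0 ω = a
  eqn : ∀ᵐ ω ∂P, ∀ t : ℝ≥0, t ≤ breakTime a b (fun s => X s ω) →
    X t ω = a + (∫ s in (0 : ℝ)..t, -(1 / ε) * energyDeriv U a (X s.toNNReal ω) s)
      + σ / √ε * W t ω

/-- The event that the chain breaks on the left-hand side, `{x_τ = b}`. -/
def breaksLeft {Ω : Type*} (a b : ℝ) (X : ℝ≥0 → Ω → ℝ) : Set Ω :=
  {ω | X (breakTime a b (fun s => X s ω)) ω = b}

/-! ### The deviation from the deterministic motion -/

/-- `V` is an even potential which agrees with `U` on `[-b, b]`, is of class `C³` on `(0, ∞)`, and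
is uniformly convex beyond `a₀`. -/
structure IsConvexExtension (V U : ℝ → ℝ) (b a₀ : ℝ) : Prop where
  continuous : Continuous V
  even : ∀ y, V (-y) = V y
  eq_of_le : ∀ y, |y| ≤ b → V y = U y
  contDiffOn : ContDiffOn ℝ 3 V (Set.Ioi 0)
  convex : ∃ u > 0, ∀ y, a₀ < |y| → u ≤ deriv (deriv V) y

/-- `x` is the solution on `[0, b/a - 1]` of the deterministic equation
`dx_t = -(1/ε) ∂H/∂x (x_t, t) dt`, `x_0 = a`, with the energy of the potential `V`; it stays in
the region `0 < x_t < 2a(1+t)`, where the equation is well-defined. -/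
structure SolvesDeterministic (V : ℝ → ℝ) (a b ε : ℝ) (x : ℝ → ℝ) : Prop where
  init : x 0 = a
  pos : ∀ t ∈ Set.Icc 0 (b / a - 1), 0 < x t
  lt : ∀ t ∈ Set.Icc 0 (b / a - 1), x t < 2 * a * (1 + t)
  eqn : ∀ t ∈ Set.Icc 0 (b / a - 1),
    HasDerivWithinAt x (-(1 / ε) * energyDeriv V a (x t) t) (Set.Icc 0 (b / a - 1)) t

/-- The upper boundary `d₊(t) = b - x_t^det`. -/
def dPlus (b : ℝ) (xdet : ℝ → ℝ) (t : ℝ) : ℝ := b - xdet t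

/-- The lower boundary `d₋(t) = 2a(1+t) - b - x_t^det`. -/
def dMinus (a b : ℝ) (xdet : ℝ → ℝ) (t : ℝ) : ℝ := 2 * a * (1 + t) - b - xdet t

/-- The space-time domain `𝓓 = {(y, t) : d₋(t) < y < d₊(t), 0 ≤ t ≤ b/a - 1}`. -/
def deviationDomain (a b : ℝ) (xdet : ℝ → ℝ) : Set (ℝ × ℝ) :=
  {p | dMinus a b xdet p.2 < p.1 ∧ p.1 < dPlus b xdet p.2 ∧ 0 ≤ p.2 ∧ p.2 ≤ b / a - 1}

/-- `τ = inf {t ≥ 0 : (y_t, t) ∉ 𝓓}`. -/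
def deviationExitTime (a b : ℝ) (xdet : ℝ → ℝ) (y : ℝ≥0 → ℝ) : ℝ≥0 :=
  sInf {t : ℝ≥0 | (y t, (t : ℝ)) ∉ deviationDomain a b xdet}

/-- The drift of the deviation process (without the factor `1/ε`):
`-V'(x) + V'(x^det) + V'(2a(1+t) - x) - V'(2a(1+t) - x^det)` with `x = x^det + y`. -/
def deviationDrift (V : ℝ → ℝ) (a : ℝ) (xdet : ℝ → ℝ) (y t : ℝ) : ℝ :=
  -deriv V (xdet t + y) + deriv V (xdet t)
    + deriv V (2 * a * (1 + t) - (xdet t + y)) - deriv V (2 * a * (1 + t) - xdet t)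

/-- `Y` has continuous paths, starts at `0`, and solves the equation of the deviation process up to
its exit from `𝓓`, where `W` is a standard Brownian motion. -/
structure SolvesDeviationSDE {Ω : Type*} [MeasurableSpace Ω] (P : Measure Ω)
    (V : ℝ → ℝ) (a b ε σ : ℝ) (xdet : ℝ → ℝ) (W Y : ℝ≥0 → Ω → ℝ) : Prop where
  brownian : IsBrownianReal W P
  continuous : ∀ᵐ ω ∂P, Continuous (fun t => Y t ω)
  init : ∀ᵐ ω ∂P, Y 0 ω = 0
  eqn : ∀ᵐ ω ∂P, ∀ t : ℝ≥0, t ≤ deviationExitTime a b xdet (fun s => Y s ω) →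
    Y t ω = (∫ s in (0 : ℝ)..t, 1 / ε * deviationDrift V a xdet (Y s.toNNReal ω) s)
      + σ / √ε * W t ω

/-- The event `{y_τ = d₊(τ)}`. -/
def deviationExitsAbove {Ω : Type*} (a b : ℝ) (xdet : ℝ → ℝ) (Y : ℝ≥0 → Ω → ℝ) : Set Ω :=
  {ω | Y (deviationExitTime a b xdet (fun s => Y s ω)) ω =
    dPlus b xdet (deviationExitTime a b xdet (fun s => Y s ω))}

end BreakingChain

end

/-! Put `T = b/a - 1` and let `z = x - a(1+t)` be the displacement from the midpoint. The chain is
intact while `|z| < a(T-t)`, a cone that closes at time `T`, and it breaks on the left when `z`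
meets the upper side. As long as `z` is small, `z` solves an equation with drift `-F(t,z)/ε - a` and
additive noise, where `F(t,·)` is odd and increasing with slopes bounded above and away from zero
(`exists_regularized_force`, `isDriftField_midDrift`, `breakTime_of_solution`). The noise being
additive, solutions with different forcings can be compared path by path (`IsForcedSolution.sub_le`,
`IsForcedSolution.le_sub`). A maximal inequality on blocks of length `ε`
(`measureReal_not_oscBound_le`) shows that, with probability tending to one, `z` stays within order
`n + ε`, where `n = σ |ln ε|^{1/2}`; hence the side reached first is decided only close to `T`.

Fast stretching: `n ≪ ε`. The term `-a` makes `z` negative after a time of order `ε`, when the cone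
is still wide, and the noise cannot undo this (`lt_of_small_noise`).

Slow stretching, upper bound: dropping the term `-a` raises the path. The undriven equation is
invariant under `z ↦ -z`, so its path meets the upper side first with probability at most `1/2`.

Slow stretching, lower bound: replacing `-a` by `-2a` lowers the path, so it suffices to bound the
probability that this lower path crosses the lower side first. Adding the slope `4a` to its forcing
on the final interval `[t₀, T]`, of length of order `n`, turns `-2a` into `+2a` there. The path
overtakes the undriven one within a time of order `ε`, while both are still inside the cone
(`crossesBelow_of_reversed`), so it crosses below first with probability at most `1/2` up to a small
error. The added slope amounts to translating one standard normal variable by a quantity of order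
`(ε n)^{1/2}/σ`, which tends to zero because `ε |ln ε|^{1/2} ≪ σ` (`measure_sample_le_shift`,
`SlowStretching.tendsto_ratio`). No analysis of the hitting law itself is needed. -/

noncomputable section

namespace BreakingChain

/-! ### Odd monotone drift fields and additively forced integral equations -/

/-- `F t` is odd, with difference quotients in `[m, M]`. -/
structure IsDriftField (F : ℝ → ℝ → ℝ) (m M : ℝ) : Prop where
  continuous : Continuous (Function.uncurry F)
  lower : ∀ t x y, x ≤ y → m * (y - x) ≤ F t y - F t x
  upper : ∀ t x y, x ≤ y → F t y - F t x ≤ M * (y - x)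
  odd : ∀ t x, F t (-x) = -F t x

/-- `z` solves `dz = -ε⁻¹ F(t, z) dt + dn` on `[0, S]`. -/
structure IsForcedSolution (F : ℝ → ℝ → ℝ) (ε S : ℝ) (n z : ℝ → ℝ) : Prop where
  continuous : Continuous z
  eqn : ∀ t ∈ Set.Icc 0 S, z t = n t - ε⁻¹ * ∫ s in (0 : ℝ)..t, F s (z s)

variable {F : ℝ → ℝ → ℝ} {m M ε S : ℝ}

lemma IsDriftField.zero (hF : IsDriftField F m M) (t : ℝ) : F t 0 = 0 := by
  have := hF.odd t 0
  simp only [neg_zero] at this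
  linarith

lemma IsDriftField.continuous_comp (hF : IsDriftField F m M) {z : ℝ → ℝ} (hz : Continuous z) :
    Continuous fun s => F s (z s) :=
  hF.continuous.comp (continuous_id.prodMk hz)

lemma isForcedSolution_zero (hF : IsDriftField F m M) :
    IsForcedSolution F ε S (fun _ => 0) (fun _ => 0) where
  continuous := continuous_const
  eqn t _ := by simp [hF.zero]

lemma IsForcedSolution.neg (hF : IsDriftField F m M) {n z : ℝ → ℝ}
    (h : IsForcedSolution F ε S n z) :
    IsForcedSolution F ε S (fun t => -n t) (fun t => -z t) where
  continuous := h.continuous.neg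
  eqn t ht := by
    simp only [hF.odd, intervalIntegral.integral_neg]
    rw [h.eqn t ht]
    ring

lemma IsForcedSolution.mono {n z : ℝ → ℝ} (h : IsForcedSolution F ε S n z) {S' : ℝ}
    (hS : S' ≤ S) : IsForcedSolution F ε S' n z :=
  ⟨h.continuous, fun t ht => h.eqn t ⟨ht.1, ht.2.trans hS⟩⟩

lemma IsForcedSolution.sub_eq (hF : IsDriftField F m M) {n₁ z₁ n₂ z₂ : ℝ → ℝ}
    (h₁ : IsForcedSolution F ε S n₁ z₁) (h₂ : IsForcedSolution F ε S n₂ z₂) {u t : ℝ}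
    (hu : u ∈ Set.Icc 0 S) (ht : t ∈ Set.Icc 0 S) :
    (z₁ t - z₂ t) - (z₁ u - z₂ u) = (n₁ t - n₂ t) - (n₁ u - n₂ u) -
      ε⁻¹ * ∫ s in u..t, (F s (z₁ s) - F s (z₂ s)) := by
  have c₁ := hF.continuous_comp h₁.continuous
  have c₂ := hF.continuous_comp h₂.continuous
  have e₁ := intervalIntegral.integral_add_adjacent_intervals
    (c₁.intervalIntegrable 0 u (μ := volume)) (c₁.intervalIntegrable u t)
  have e₂ := intervalIntegral.integral_add_adjacent_intervals
    (c₂.intervalIntegrable 0 u (μ := volume)) (c₂.intervalIntegrable u t)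
  rw [intervalIntegral.integral_sub (c₁.intervalIntegrable _ _) (c₂.intervalIntegrable _ _),
    h₁.eqn t ht, h₁.eqn u hu, h₂.eqn t ht, h₂.eqn u hu, ← e₁, ← e₂]
  ring

/-- Last-exit decomposition: all comparison estimates argue from the last time at which the
difference of two solutions was at most the level `B`, after which the restoring force has a
definite size. -/
lemma exists_last_le {e : ℝ → ℝ} (he : Continuous e) {s t B : ℝ} (ht : B < e t) :
    (∀ v ∈ Set.Icc s t, B < e v) ∨
      ∃ u ∈ Set.Ico s t, e u ≤ B ∧ ∀ v ∈ Set.Ioc u t, B < e v := by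
  by_cases h : ∀ v ∈ Set.Icc s t, B < e v
  · exact Or.inl h
  right
  push Not at h
  obtain ⟨v, hv, hvB⟩ := h
  have hK : IsCompact (Set.Icc s t ∩ {v | e v ≤ B}) :=
    isCompact_Icc.inter_right (isClosed_le he continuous_const)
  obtain ⟨u, ⟨hu, huB⟩, hmax⟩ := hK.exists_isGreatest ⟨v, hv, hvB⟩
  have hut : u ≠ t := by
    rintro rfl
    exact absurd ht (not_lt.2 huB)
  refine ⟨u, ⟨hu.1, lt_of_le_of_ne hu.2 hut⟩, huB, fun w hw => ?_⟩
  by_contra hc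
  exact absurd (hmax ⟨⟨hu.1.trans hw.1.le, hw.2⟩, not_lt.1 hc⟩) (not_le.2 hw.1)

/-- Comparison: an upper bound on the increments of the difference of the forcings bounds the
difference of the solutions. -/
lemma IsForcedSolution.sub_le (hF : IsDriftField F m M) (hm : 0 ≤ m) (hε : 0 < ε)
    {n₁ z₁ n₂ z₂ : ℝ → ℝ}
    (h₁ : IsForcedSolution F ε S n₁ z₁) (h₂ : IsForcedSolution F ε S n₂ z₂) {α β B : ℝ}
    (hB : 0 ≤ B) (hβ : β * ε ≤ m * B) (hα : 0 ≤ α)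
    (hn : ∀ u t, 0 ≤ u → u ≤ t → t ≤ S → (n₁ t - n₂ t) - (n₁ u - n₂ u) ≤ α + β * (t - u))
    (h0' : ∀ t, 0 ≤ t → t ≤ S → (n₁ t - n₂ t) ≤ α + β * t)
    {t : ℝ} (ht : t ∈ Set.Icc 0 S) : z₁ t - z₂ t ≤ B + α := by
  have c₁ := hF.continuous_comp h₁.continuous
  have c₂ := hF.continuous_comp h₂.continuous
  -- While the difference exceeds `B`, the restoring drift is at least `m B / ε ≥ β` and absorbs the
  -- linear part of the forcing, leaving only the jump allowance `α`.
  have key : ∀ u ∈ Set.Icc 0 t, (∀ v ∈ Set.Ioo u t, B ≤ z₁ v - z₂ v) →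
      β * (t - u) ≤ ε⁻¹ * ∫ s in u..t, (F s (z₁ s) - F s (z₂ s)) := by
    intro u hu hv
    have h1 : ∫ s in u..t, m * B ≤ ∫ s in u..t, (F s (z₁ s) - F s (z₂ s)) := by
      refine intervalIntegral.integral_mono_on_of_le_Ioo hu.2 (by simp)
        ((c₁.sub c₂).intervalIntegrable _ _) fun v hv' => ?_
      have := hv v hv'
      have h3 := hF.lower v (z₂ v) (z₁ v) (by linarith)
      nlinarith
    rw [intervalIntegral.integral_const, smul_eq_mul] at h1
    rw [inv_mul_eq_div, le_div_iff₀ hε]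
    nlinarith [hu.2]
  by_contra hc
  push Not at hc
  have hcB : B < z₁ t - z₂ t := by linarith
  rcases exists_last_le (s := 0) (h₁.continuous.sub h₂.continuous) hcB with h | ⟨u, hu, huB, hv⟩
  · have h1 := key 0 ⟨le_rfl, ht.1⟩ fun v hv => (h v ⟨hv.1.le, hv.2.le⟩).le
    have h2 := h₁.sub_eq hF h₂ ⟨le_rfl, ht.1.trans ht.2⟩ ht
    have h3 := h0' t ht.1 ht.2
    have h4 := h₁.eqn 0 ⟨le_rfl, ht.1.trans ht.2⟩
    have h5 := h₂.eqn 0 ⟨le_rfl, ht.1.trans ht.2⟩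
    simp only [intervalIntegral.integral_same, mul_zero, sub_zero] at h4 h5 h1
    linarith
  · have h1 := key u ⟨hu.1, hu.2.le⟩ fun v hv' => (hv v ⟨hv'.1, hv'.2.le⟩).le
    have h2 := h₁.sub_eq hF h₂ ⟨hu.1, hu.2.le.trans ht.2⟩ ht
    have h3 := hn u t hu.1 hu.2.le ht.2
    simp only [Pi.sub_apply] at huB
    linarith

/-- The comparison estimate for forcings which agree at time `0`. -/
lemma IsForcedSolution.sub_le_of_zero (hF : IsDriftField F m M) (hm : 0 ≤ m) (hε : 0 < ε)
    {n₁ z₁ n₂ z₂ : ℝ → ℝ}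
    (h₁ : IsForcedSolution F ε S n₁ z₁) (h₂ : IsForcedSolution F ε S n₂ z₂) {α β B : ℝ}
    (hB : 0 ≤ B) (hβ : β * ε ≤ m * B) (hα : 0 ≤ α) (h0 : n₁ 0 = n₂ 0)
    (hn : ∀ u t, 0 ≤ u → u ≤ t → t ≤ S → (n₁ t - n₂ t) - (n₁ u - n₂ u) ≤ α + β * (t - u))
    {t : ℝ} (ht : t ∈ Set.Icc 0 S) : z₁ t - z₂ t ≤ B + α := by
  refine h₁.sub_le hF hm hε h₂ hB hβ hα hn (fun t h h' => ?_) ht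
  have := hn 0 t le_rfl h h'
  simp only [sub_zero] at this
  linarith

lemma IsForcedSolution.le_of_monotone (hF : IsDriftField F m M) (hm : 0 ≤ m) (hε : 0 < ε)
    {n₁ z₁ n₂ z₂ : ℝ → ℝ}
    (h₁ : IsForcedSolution F ε S n₁ z₁) (h₂ : IsForcedSolution F ε S n₂ z₂)
    (h0 : n₁ 0 = n₂ 0)
    (hn : ∀ u t, 0 ≤ u → u ≤ t → t ≤ S → (n₁ t - n₂ t) - (n₁ u - n₂ u) ≤ 0)
    {t : ℝ} (ht : t ∈ Set.Icc 0 S) : z₁ t ≤ z₂ t := by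
  have := h₁.sub_le_of_zero hF hm hε h₂ (α := 0) (β := 0) (B := 0) le_rfl (by simp) le_rfl h0
    (by simpa using hn) ht
  linarith

lemma IsForcedSolution.unique (hF : IsDriftField F m M) (hm : 0 ≤ m) (hε : 0 < ε)
    {n₁ z₁ n₂ z₂ : ℝ → ℝ}
    (h₁ : IsForcedSolution F ε S n₁ z₁) (h₂ : IsForcedSolution F ε S n₂ z₂)
    (hn : ∀ t ∈ Set.Icc 0 S, n₁ t = n₂ t) {t : ℝ} (ht : t ∈ Set.Icc 0 S) : z₁ t = z₂ t := by
  have h0 := hn 0 ⟨le_rfl, ht.1.trans ht.2⟩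
  refine le_antisymm (h₁.le_of_monotone hF hm hε h₂ h0 (fun u t hu hut ht => ?_) ht)
    (h₂.le_of_monotone hF hm hε h₁ h0.symm (fun u t hu hut ht => ?_) ht) <;>
  rw [hn t ⟨hu.trans hut, ht⟩, hn u ⟨hu, hut.trans ht⟩] <;> simp

/-- Lower bound on the difference of two solutions after the forcings have drifted apart. -/
lemma IsForcedSolution.le_sub (hF : IsDriftField F m M) (hm : 0 ≤ m) (hM : 0 ≤ M) (hε : 0 < ε)
    {n₁ z₁ n₂ z₂ : ℝ → ℝ}
    (h₁ : IsForcedSolution F ε S n₁ z₁) (h₂ : IsForcedSolution F ε S n₂ z₂) {t₀ c κ α θ : ℝ}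
    (ht₀ : 0 ≤ t₀) (hθ : 0 < θ) (hθκ : 2 * M * θ ≤ κ * ε) (h0 : -c ≤ z₁ t₀ - z₂ t₀)
    (hn : ∀ u t, t₀ ≤ u → u ≤ t → t ≤ S →
      κ * (t - u) - α ≤ (n₁ t - n₂ t) - (n₁ u - n₂ u)) (hα : 0 ≤ α)
    {t : ℝ} (ht : t₀ ≤ t) (htS : t ≤ S) (hc : c + θ ≤ κ / 2 * (t - t₀)) :
    θ - α ≤ z₁ t - z₂ t := by
  have c₁ := hF.continuous_comp h₁.continuous
  have c₂ := hF.continuous_comp h₂.continuous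
  have hκ : 0 ≤ κ := by
    by_contra hκ
    nlinarith [mul_nonneg hM hθ.le]
  -- Below level `θ` the restoring force costs at most `M θ / ε ≤ κ / 2`, so the difference still
  -- grows at net rate `κ / 2`.
  have key : ∀ u ∈ Set.Icc t₀ t, (∀ v ∈ Set.Ioo u t, z₁ v - z₂ v ≤ θ) →
      ε⁻¹ * ∫ s in u..t, (F s (z₁ s) - F s (z₂ s)) ≤ κ / 2 * (t - u) := by
    intro u hu hv
    have h1 : ∫ s in u..t, (F s (z₁ s) - F s (z₂ s)) ≤ ∫ s in u..t, M * θ := by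
      refine intervalIntegral.integral_mono_on_of_le_Ioo hu.2
        ((c₁.sub c₂).intervalIntegrable _ _) (by simp) fun v hv' => ?_
      have h2 := hv v hv'
      rcases le_total (z₁ v) (z₂ v) with h6 | h6
      · have h7 := hF.lower v (z₁ v) (z₂ v) h6
        nlinarith [mul_nonneg hM hθ.le, mul_nonneg hm (sub_nonneg.2 h6)]
      · have h7 := hF.upper v (z₂ v) (z₁ v) h6
        nlinarith
    rw [intervalIntegral.integral_const, smul_eq_mul] at h1
    rw [inv_mul_eq_div, div_le_iff₀ hε]
    nlinarith [hu.2]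
  by_contra hcon
  push Not at hcon
  have htS' : t ∈ Set.Icc 0 S := ⟨ht₀.trans ht, htS⟩
  have he : Continuous fun s => -(z₁ s - z₂ s) := (h₁.continuous.sub h₂.continuous).neg
  rcases exists_last_le (s := t₀) (t := t) (B := -θ) he (by linarith) with
    h | ⟨u, hu, huB, hv⟩
  · have h1 := key t₀ ⟨le_rfl, ht⟩ fun v hv => by linarith [h v ⟨hv.1.le, hv.2.le⟩]
    have h2 := h₁.sub_eq hF h₂ ⟨ht₀, ht.trans htS⟩ htS'
    have h3 := hn t₀ t le_rfl ht htS
    linarith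
  · have h1 := key u ⟨hu.1, hu.2.le⟩ fun v hv' => by linarith [hv v ⟨hv'.1, hv'.2.le⟩]
    have h2 := h₁.sub_eq hF h₂ ⟨ht₀.trans hu.1, hu.2.le.trans htS⟩ htS'
    have h3 := hn u t hu.1 hu.2.le htS
    have h4 : 0 ≤ κ / 2 * (t - u) := mul_nonneg (by linarith) (by linarith [hu.2])
    linarith

/-- Strict comparison for forcings drifting apart at a positive rate. -/
lemma IsForcedSolution.lt_of_rate (hF : IsDriftField F m M) (hm : 0 ≤ m) (hM : 0 < M)
    (hε : 0 < ε) {n₁ z₁ n₂ z₂ : ℝ → ℝ}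
    (h₁ : IsForcedSolution F ε S n₁ z₁) (h₂ : IsForcedSolution F ε S n₂ z₂) {κ : ℝ}
    (hκ : 0 < κ) (h0 : n₁ 0 = n₂ 0)
    (hn : ∀ u t, 0 ≤ u → u ≤ t → t ≤ S → κ * (t - u) ≤ (n₁ t - n₂ t) - (n₁ u - n₂ u))
    {t : ℝ} (ht : 0 < t) (htS : t ≤ S) : z₂ t < z₁ t := by
  set θ := min (κ * ε / (2 * M)) (κ / 2 * t) with hθ
  have hθ0 : 0 < θ := lt_min (by positivity) (by positivity)
  have h3 : 0 ≤ S := ht.le.trans htS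
  have h4 := h₁.eqn 0 ⟨le_rfl, h3⟩
  have h5 := h₂.eqn 0 ⟨le_rfl, h3⟩
  simp only [intervalIntegral.integral_same, mul_zero, sub_zero] at h4 h5
  have h6 : 2 * M * θ ≤ κ * ε := by
    have : θ ≤ κ * ε / (2 * M) := min_le_left _ _
    rw [le_div_iff₀ (by positivity)] at this
    linarith
  have := h₁.le_sub hF hm hM.le hε h₂ (t₀ := 0) (c := 0) (κ := κ) (α := 0) (θ := θ) le_rfl hθ0 h6
    (by rw [h4, h5, h0]; simp) (by simpa using hn) le_rfl ht.le htS
    (by rw [zero_add, sub_zero]; exact min_le_right _ _)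
  linarith

/-! ### Existence -/

/-- Truncation destroys strict monotonicity, so the lower slope becomes `0`; this is enough for the
comparison estimates with `β = 0` and `B = 0`. -/
lemma isDriftField_clamp (hF : IsDriftField F m M) (hm : 0 ≤ m) (hM : 0 ≤ M) {R : ℝ}
    (hR : 0 ≤ R) : IsDriftField (fun t x => F t (max (-R) (min R x))) 0 M where
  continuous := by
    have : Continuous fun p : ℝ × ℝ => (p.1, max (-R) (min R p.2)) := by fun_prop
    exact hF.continuous.comp this
  lower t x y hxy := by
    have h : max (-R) (min R x) ≤ max (-R) (min R y) :=
      max_le_max le_rfl (min_le_min le_rfl hxy)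
    have := hF.lower t _ _ h
    nlinarith [mul_nonneg hm (sub_nonneg.2 h)]
  upper t x y hxy := by
    have h : max (-R) (min R x) ≤ max (-R) (min R y) :=
      max_le_max le_rfl (min_le_min le_rfl hxy)
    have h1 := hF.upper t _ _ h
    have h2 : max (-R) (min R y) - max (-R) (min R x) ≤ y - x := by
      rcases min_cases R x with h1 | h1 <;> rcases min_cases R y with h2 | h2 <;>
      rcases max_cases (-R) (min R x) with h3 | h3 <;>
      rcases max_cases (-R) (min R y) with h4 | h4 <;> linarith
    nlinarith
  odd t x := by
    rw [← hF.odd]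
    congr 1
    rcases min_cases R x with h1 | h1 <;> rcases min_cases R (-x) with h2 | h2 <;>
    rcases max_cases (-R) (min R x) with h3 | h3 <;>
    rcases max_cases (-R) (min R (-x)) with h4 | h4 <;> linarith

lemma IsDriftField.abs_sub_le (hF : IsDriftField F m M) (hm : 0 ≤ m) (t x y : ℝ) :
    |F t x - F t y| ≤ M * |x - y| := by
  rcases le_total x y with h | h
  · have h1 := hF.lower t x y h
    have h2 := hF.upper t x y h
    have := mul_nonneg hm (sub_nonneg.2 h)
    rw [abs_sub_comm, abs_of_nonneg (by linarith), abs_sub_comm, abs_of_nonneg (by linarith)]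
    exact h2
  · have h1 := hF.lower t y x h
    have h2 := hF.upper t y x h
    have := mul_nonneg hm (sub_nonneg.2 h)
    rw [abs_of_nonneg (by linarith), abs_of_nonneg (by linarith)]
    exact h2

/-- The forcing is only continuous, but `q = z - n` satisfies an ordinary differential equation to
which Picard–Lindelöf applies on the whole of `[0, S]`, the field being bounded. -/
lemma exists_isForcedSolution_of_bounded (hF : IsDriftField F m M) (hm : 0 ≤ m) (hM : 0 ≤ M)
    (hε : 0 < ε) (hS : 0 ≤ S) {K : ℝ} (hK : ∀ t x, |F t x| ≤ K) {n : ℝ → ℝ} (hn : Continuous n) :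
    ∃ z, IsForcedSolution F ε S n z := by
  have hK0 : 0 ≤ K := (abs_nonneg _).trans (hK 0 0)
  let f : ℝ → ℝ → ℝ := fun t q => -(ε⁻¹ * F t (q + n t))
  have hpl : IsPicardLindelof f (tmin := 0) (tmax := S) ⟨0, le_rfl, hS⟩ (0 : ℝ)
      (Real.toNNReal (ε⁻¹ * K * S)) 0 (Real.toNNReal (ε⁻¹ * K)) (Real.toNNReal (ε⁻¹ * M)) := by
    refine ⟨fun t _ => ?_, fun x _ => ?_, fun t _ x _ => ?_, ?_⟩
    · refine LipschitzOnWith.of_dist_le_mul fun x _ y _ => ?_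
      rw [Real.coe_toNNReal _ (by positivity), Real.dist_eq, Real.dist_eq]
      have := hF.abs_sub_le hm t (y + n t) (x + n t)
      have h2 : f t x - f t y = ε⁻¹ * (F t (y + n t) - F t (x + n t)) := by simp only [f]; ring
      rw [h2, abs_mul, abs_of_pos (by positivity : 0 < ε⁻¹), mul_assoc]
      refine mul_le_mul_of_nonneg_left (this.trans_eq ?_) (by positivity)
      rw [abs_sub_comm]; congr 2; ring
    · exact ((hF.continuous_comp (by fun_prop : Continuous fun t => x + n t)).const_mul _
        |>.neg).continuousOn
    · rw [Real.coe_toNNReal _ (by positivity), Real.norm_eq_abs, abs_neg, abs_mul,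
        abs_of_pos (by positivity : 0 < ε⁻¹)]
      exact mul_le_mul_of_nonneg_left (hK _ _) (by positivity)
    · rw [Real.coe_toNNReal _ (by positivity), Real.coe_toNNReal _ (by positivity)]
      simp [hS]
  obtain ⟨q, hq0, hq⟩ := hpl.exists_eq_forall_mem_Icc_hasDerivWithinAt₀
  have hqc : ContinuousOn q (Set.Icc 0 S) := fun t ht => (hq t ht).continuousWithinAt
  let z : ℝ → ℝ := fun t => q (Set.projIcc 0 S hS t) + n t
  have hz : Continuous z := by
    have : Continuous fun t => q (Set.projIcc 0 S hS t) :=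
      (continuousOn_iff_continuous_domRestrict.1 hqc).comp continuous_projIcc
    exact this.add hn
  refine ⟨z, hz, fun t ht => ?_⟩
  have hzq : ∀ s ∈ Set.Icc 0 S, z s = q s + n s := fun s hs => by
    simp only [z, Set.projIcc_of_mem hS hs]
  have hint : ∫ s in (0 : ℝ)..t, -(ε⁻¹ * F s (z s)) = q t - q 0 := by
    refine intervalIntegral.integral_eq_sub_of_hasDeriv_right_of_le ht.1
      (hqc.mono (Set.Icc_subset_Icc_right ht.2)) (fun s hs => ?_)
      (((hF.continuous_comp hz).const_mul _).neg.intervalIntegrable _ _)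
    have hs' : s ∈ Set.Icc 0 S := ⟨hs.1.le, hs.2.le.trans ht.2⟩
    rw [hzq s hs']
    refine (hq s hs').mono_of_mem_nhdsWithin ?_
    exact mem_nhdsWithin_of_mem_nhds (Icc_mem_nhds hs.1 (hs.2.trans_le ht.2))
  rw [intervalIntegral.integral_neg, intervalIntegral.integral_const_mul] at hint
  have hq0' : q 0 = 0 := hq0
  rw [hzq t ht]
  linarith

theorem exists_isForcedSolution (hF : IsDriftField F m M) (hm : 0 ≤ m) (hM : 0 ≤ M)
    (hε : 0 < ε) (hS : 0 ≤ S) {n : ℝ → ℝ} (hn : Continuous n) :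
    ∃ z, IsForcedSolution F ε S n z := by
  obtain ⟨d, hd⟩ := (isCompact_Icc (a := (0 : ℝ)) (b := S)).exists_bound_of_continuousOn
    hn.continuousOn
  have hd0 : 0 ≤ d := (norm_nonneg _).trans (hd 0 ⟨le_rfl, hS⟩)
  simp only [Real.norm_eq_abs] at hd
  -- The increments of `n` are at most `2 d`, so comparison with the zero solution keeps the
  -- solution of the truncated equation in `[-2d, 2d]`, where the truncation has no effect.
  have hR : 0 ≤ 2 * d := by linarith
  have hG := isDriftField_clamp hF hm hM hR
  obtain ⟨z, hz⟩ := exists_isForcedSolution_of_bounded hG le_rfl hM hε hS (K := M * (2 * d))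
    (fun t x => by
      have := hF.abs_sub_le hm t (max (-(2 * d)) (min (2 * d) x)) 0
      rw [hF.zero, sub_zero, sub_zero] at this
      refine this.trans (mul_le_mul_of_nonneg_left ?_ hM)
      rw [abs_le]
      exact ⟨le_max_left _ _, max_le (by linarith) (min_le_left _ _)⟩) hn
  refine ⟨z, hz.continuous, fun t ht => ?_⟩
  have h0 := isForcedSolution_zero hG (ε := ε) (S := S)
  have hup : ∀ s ∈ Set.Icc 0 S, |z s| ≤ 2 * d := by
    intro s hs
    rw [abs_le]
    have hb : ∀ u, 0 ≤ u → u ≤ S → n u ≤ d ∧ -d ≤ n u := fun u h h' =>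
      ⟨(abs_le.1 (hd u ⟨h, h'⟩)).2, (abs_le.1 (hd u ⟨h, h'⟩)).1⟩
    have h1 := hz.sub_le hG le_rfl hε h0 (α := 2 * d) (β := 0) (B := 0) le_rfl (by simp) hR
      (fun u t hu hut htS => by linarith [(hb u hu (hut.trans htS)).2, (hb t (hu.trans hut) htS).1])
      (fun t h h' => by linarith [(hb t h h').1]) hs
    have h2 := h0.sub_le hG le_rfl hε hz (α := 2 * d) (β := 0) (B := 0) le_rfl (by simp) hR
      (fun u t hu hut htS => by linarith [(hb u hu (hut.trans htS)).1, (hb t (hu.trans hut) htS).2])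
      (fun t h h' => by linarith [(hb t h h').2]) hs
    constructor <;> linarith
  rw [hz.eqn t ht]
  congr 2
  refine intervalIntegral.integral_congr fun s hs => ?_
  rw [Set.uIcc_of_le ht.1] at hs
  have := abs_le.1 (hup s ⟨hs.1, hs.2.trans ht.2⟩)
  rw [min_eq_right this.2, max_eq_right this.1]

/-! ### The solution map and crossings of the cone `|z| ≤ a (T - t)` -/

/-- The solution on `[0, S]` of `dz = -ε⁻¹ F(t, z) dt + dn`. -/
def solve (F : ℝ → ℝ → ℝ) (ε S : ℝ) (n : ℝ → ℝ) : ℝ → ℝ :=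
  open Classical in
  if h : ∃ z, IsForcedSolution F ε S n z then h.choose else 0

variable {F : ℝ → ℝ → ℝ} {m M ε T : ℝ}

lemma isForcedSolution_solve (hF : IsDriftField F m M) (hm : 0 ≤ m) (hM : 0 ≤ M)
    (hε : 0 < ε) (hT : 0 ≤ T) {n : ℝ → ℝ} (hn : Continuous n) :
    IsForcedSolution F ε T n (solve F ε T n) := by
  have h := exists_isForcedSolution hF hm hM hε hT hn
  rw [solve, dif_pos h]
  exact h.choose_spec

/-- Lipschitz dependence on the forcing in the uniform norm; it makes crossing events measurable.
The factor `2` arises because the increments of `n₁ - n₂` are at most `2 d`. -/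
lemma solve_sub_le (hF : IsDriftField F m M) (hm : 0 ≤ m) (hM : 0 ≤ M)
    (hε : 0 < ε) (hT : 0 ≤ T) {n₁ n₂ : ℝ → ℝ} (hn₁ : Continuous n₁) (hn₂ : Continuous n₂) {d : ℝ}
    (hd : ∀ t ∈ Set.Icc 0 T, |n₁ t - n₂ t| ≤ d) {t : ℝ} (ht : t ∈ Set.Icc 0 T) :
    |solve F ε T n₁ t - solve F ε T n₂ t| ≤ 2 * d := by
  have h₁ := isForcedSolution_solve hF hm hM hε hT hn₁
  have h₂ := isForcedSolution_solve hF hm hM hε hT hn₂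
  have hd0 : 0 ≤ d := (abs_nonneg _).trans (hd t ht)
  have hb : ∀ u, 0 ≤ u → u ≤ T → -d ≤ n₁ u - n₂ u ∧ n₁ u - n₂ u ≤ d := fun u h h' =>
    abs_le.1 (hd u ⟨h, h'⟩)
  have e₁ := h₁.sub_le hF hm hε h₂ (α := 2 * d) (β := 0) (B := 0) le_rfl (by simp) (by linarith)
    (fun u t hu hut htT => by linarith [(hb u hu (hut.trans htT)).1, (hb t (hu.trans hut) htT).2])
    (fun t h h' => by linarith [(hb t h h').2]) ht
  have e₂ := h₂.sub_le hF hm hε h₁ (α := 2 * d) (β := 0) (B := 0) le_rfl (by simp) (by linarith)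
    (fun u t hu hut htT => by linarith [(hb u hu (hut.trans htT)).2, (hb t (hu.trans hut) htT).1])
    (fun t h h' => by linarith [(hb t h h').1]) ht
  rw [abs_le]
  constructor <;> linarith

lemma solve_neg (hF : IsDriftField F m M) (hm : 0 ≤ m) (hM : 0 ≤ M)
    (hε : 0 < ε) (hT : 0 ≤ T) {n : ℝ → ℝ} (hn : Continuous n) {t : ℝ} (ht : t ∈ Set.Icc 0 T) :
    solve F ε T (fun s => -n s) t = -solve F ε T n t :=
  (isForcedSolution_solve hF hm hM hε hT hn.neg).unique hF hm hε
    ((isForcedSolution_solve hF hm hM hε hT hn).neg hF) (fun _ _ => rfl) ht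

/-- The path `z` crosses the lower boundary of the cone `|z| ≤ a (T - t)` before the upper one. -/
def CrossesBelow (a T : ℝ) (z : ℝ → ℝ) : Prop :=
  ∃ t ∈ Set.Icc 0 T, z t < -(a * (T - t)) ∧ ∀ s ∈ Set.Icc 0 t, z s ≤ a * (T - s)

/-- Crossing is strict on one side and weak on the other precisely so that the events for `z` and
`-z` are disjoint, even at the tip of the cone. -/
lemma CrossesBelow.not_neg {a : ℝ} {z : ℝ → ℝ} (h : CrossesBelow a T z) :
    ¬ CrossesBelow a T (fun t => -z t) := by
  rintro ⟨t₂, ht₂, hlt₂, hs₂⟩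
  obtain ⟨t₁, ht₁, hlt₁, hs₁⟩ := h
  rcases le_total t₁ t₂ with h | h
  · linarith [hs₂ t₁ ⟨ht₁.1, h⟩]
  · linarith [hs₁ t₂ ⟨ht₂.1, h⟩]

lemma CrossesBelow.congr {a : ℝ} {z z' : ℝ → ℝ} (h : CrossesBelow a T z)
    (he : ∀ t ∈ Set.Icc 0 T, z t = z' t) : CrossesBelow a T z' := by
  obtain ⟨t, ht, hlt, hs⟩ := h
  exact ⟨t, ht, he t ht ▸ hlt, fun s hs' => he s ⟨hs'.1, hs'.2.trans ht.2⟩ ▸ hs s hs'⟩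

/-- Approximating from the left keeps the new time inside the interval on which the other side of
the cone has not been crossed. -/
lemma exists_rat_left_of_mem_nhds {s : ℝ} (hs : 0 < s) {O : Set ℝ} (hO : O ∈ 𝓝 s) :
    ∃ q : ℚ, 0 < (q : ℝ) ∧ (q : ℝ) < s ∧ (q : ℝ) ∈ O := by
  obtain ⟨l, u, hlu, hsub⟩ := mem_nhds_iff_exists_Ioo_subset.1 hO
  obtain ⟨q, hq1, hq2⟩ := exists_rat_btwn (max_lt hlu.1 hs)
  exact ⟨q, (le_max_right _ _).trans_lt hq1, hq2,
    hsub ⟨(le_max_left _ _).trans_lt hq1, hq2.trans hlu.2⟩⟩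

lemma crossesBelow_iff_rat {a : ℝ} {z : ℝ → ℝ} (hz : Continuous z) :
    CrossesBelow a T z ↔ ∃ q : ℚ, (q : ℝ) ∈ Set.Icc 0 T ∧ z q < -(a * (T - q)) ∧
      ∀ q' : ℚ, (q' : ℝ) ∈ Set.Icc 0 (q : ℝ) → z q' ≤ a * (T - q') := by
  constructor
  · rintro ⟨t, ht, hlt, hs⟩
    rcases ht.1.eq_or_lt with h0 | h0
    · subst h0
      exact ⟨0, by simpa using ht.2, by simpa using hlt, fun q' hq' => hs q' (by simpa using hq')⟩
    · have hO : {v | z v < -(a * (T - v))} ∈ 𝓝 t :=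
        (isOpen_lt hz (by fun_prop)).mem_nhds hlt
      obtain ⟨q, hq0, hqt, hq⟩ := exists_rat_left_of_mem_nhds h0 hO
      exact ⟨q, ⟨hq0.le, hqt.le.trans ht.2⟩, hq, fun q' hq' => hs q' ⟨hq'.1, hq'.2.trans hqt.le⟩⟩
  · rintro ⟨q, hq, hlt, hs⟩
    refine ⟨q, hq, hlt, fun s hs' => ?_⟩
    rcases hs'.1.eq_or_lt with h0 | h0
    · subst h0
      simpa using hs 0 (by simpa using hq.1)
    · by_contra hc
      have hO : {v | a * (T - v) < z v} ∈ 𝓝 s :=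
        (isOpen_lt (by fun_prop) hz).mem_nhds (not_le.1 hc)
      obtain ⟨q', hq0, hqt, hq'⟩ := exists_rat_left_of_mem_nhds h0 hO
      exact absurd (hs q' ⟨hq0.le, hqt.le.trans hs'.2⟩) (not_le.2 hq')

/-- The increments of `w` over time intervals of length `h` are bounded by `r (1 + h / ε)`. -/
def OscBound (w : ℝ → ℝ) (ε T r : ℝ) : Prop :=
  ∀ u t, 0 ≤ u → u ≤ t → t ≤ T → |w t - w u| ≤ r * (1 + (t - u) / ε)

/-! ### Pathwise position of solutions relative to the cone under regular noise -/

section Paths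

variable {a r : ℝ} {w Z Z' : ℝ → ℝ}

/-- Comparison with the zero solution: the noise contributes slope `r / ε` and the deterministic
forcing slope `c`, together balanced by the restoring force at height `(r + c ε) / m`. -/
lemma abs_solution_le (hF : IsDriftField F m M) (hm : 0 < m) (hε : 0 < ε) (hr : 0 ≤ r)
    (hw : OscBound w ε T r) (hw0 : w 0 = 0) {h : ℝ → ℝ} (h0 : h 0 = 0) {c : ℝ} (hc : 0 ≤ c)
    (hh : ∀ u t, 0 ≤ u → u ≤ t → t ≤ T → |h t - h u| ≤ c * (t - u))
    (hZ : IsForcedSolution F ε T (fun t => w t + h t) Z) {t : ℝ} (ht : t ∈ Set.Icc 0 T) :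
    |Z t| ≤ r + (r + c * ε) / m := by
  have hz := isForcedSolution_zero hF (ε := ε) (S := T)
  have hβ : (r / ε + c) * ε ≤ m * ((r + c * ε) / m) := by
    field_simp; exact le_rfl
  have hinc : ∀ u t, 0 ≤ u → u ≤ t → t ≤ T →
      |w t - w u| + |h t - h u| ≤ r + (r / ε + c) * (t - u) := fun u t hu hut ht => by
    have h1 := hw u t hu hut ht
    have h2 := hh u t hu hut ht
    have h3 : r * (1 + (t - u) / ε) = r + r / ε * (t - u) := by ring
    linarith
  have e₁ := hZ.sub_le_of_zero hF hm.le hε hz (by positivity) hβ hr (by simp [hw0, h0])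
    (fun u t hu hut ht => by
      have := hinc u t hu hut ht
      have h1 := le_abs_self (w t - w u)
      have h2 := le_abs_self (h t - h u)
      linarith) ht
  have e₂ := hz.sub_le_of_zero hF hm.le hε hZ (by positivity) hβ hr (by simp [hw0, h0])
    (fun u t hu hut ht => by
      have := hinc u t hu hut ht
      have h1 := neg_abs_le (w t - w u)
      have h2 := neg_abs_le (h t - h u)
      linarith) ht
  rw [abs_le]
  constructor <;> linarith

/-- Removing the downward forcing raises the path, strictly at positive times, so touching the upper
side becomes a genuine crossing. -/
lemma crossesBelow_neg_of_hits_above (hF : IsDriftField F m M) (hm : 0 < m) (hM : 0 < M)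
    (hε : 0 < ε) (ha : 0 < a) (hZ : IsForcedSolution F ε T (fun t => w t - a * t) Z)
    (hZ' : IsForcedSolution F ε T w Z') {τ : ℝ} (hτ0 : 0 < τ) (hτT : τ ≤ T)
    (hτ : Z τ = a * (T - τ)) (hs : ∀ s ∈ Set.Icc 0 τ, -(a * (T - s)) ≤ Z s) :
    CrossesBelow a T (fun t => -Z' t) := by
  refine ⟨τ, ⟨hτ0.le, hτT⟩, ?_, fun s hs' => ?_⟩
  · have := hZ'.lt_of_rate hF hm.le hM hε hZ ha (by simp)
      (fun u t _ _ _ => by linarith) hτ0 hτT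
    linarith
  · have := hZ.le_of_monotone hF hm.le hε hZ' (by simp)
      (fun u t _ hut _ => by nlinarith) ⟨hs'.1, hs'.2.trans hτT⟩
    linarith [hs s hs']

lemma crossesBelow_of_hits_below (hF : IsDriftField F m M) (hm : 0 < m) (hM : 0 < M)
    (hε : 0 < ε) (ha : 0 < a) (hZ : IsForcedSolution F ε T (fun t => w t - a * t) Z)
    (hZ' : IsForcedSolution F ε T (fun t => w t - 2 * a * t) Z') {τ : ℝ} (hτ0 : 0 < τ)
    (hτT : τ ≤ T) (hτ : Z τ = -(a * (T - τ))) (hs : ∀ s ∈ Set.Icc 0 τ, Z s ≤ a * (T - s)) :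
    CrossesBelow a T Z' := by
  refine ⟨τ, ⟨hτ0.le, hτT⟩, ?_, fun s hs' => ?_⟩
  · have := hZ.lt_of_rate hF hm.le hM hε hZ' ha (by simp)
      (fun u t _ _ _ => by linarith) hτ0 hτT
    linarith
  · have := hZ'.le_of_monotone hF hm.le hε hZ (by simp)
      (fun u t _ hut _ => by nlinarith) ⟨hs'.1, hs'.2.trans hτT⟩
    linarith [hs s hs']

/-- The forcing which pulls down at rate `2a` up to time `t₀` and pushes up at rate `2a` afterwards
leads to a path which is above the unforced one after a time of order `ε`. -/
lemma crossesBelow_of_reversed (hF : IsDriftField F m M) (hm : 0 < m) (hM : 0 < M)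
    (hε : 0 < ε) (ha : 0 < a) (hr : 0 ≤ r) (hw : OscBound w ε T r) (hw0 : w 0 = 0) {t₀ : ℝ}
    (ht₀ : 0 ≤ t₀) (hsep : r + (r + 2 * a * ε) / m + a * (ε * (2 / m + 1 / M)) < a * (T - t₀))
    (hZ : IsForcedSolution F ε T (fun t => w t + (4 * a * max (t - t₀) 0 - 2 * a * t)) Z)
    (hZ' : IsForcedSolution F ε T w Z') (h : CrossesBelow a T Z) : CrossesBelow a T Z' := by
  have hmax : ∀ u t : ℝ, u ≤ t → 0 ≤ max (t - t₀) 0 - max (u - t₀) 0 ∧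
      max (t - t₀) 0 - max (u - t₀) 0 ≤ t - u := fun u t hut => by
    rcases max_cases (t - t₀) 0 with h1 | h1 <;> rcases max_cases (u - t₀) 0 with h2 | h2 <;>
    constructor <;> linarith
  have hC : 0 < ε * (2 / m + 1 / M) := by positivity
  set v₀ := t₀ + ε * (2 / m + 1 / M) with hv₀
  have hsep' : r + (r + 2 * a * ε) / m < a * (T - v₀) := by rw [hv₀]; nlinarith
  have hb : ∀ t ∈ Set.Icc 0 T, |Z t| ≤ r + (r + 2 * a * ε) / m := fun t ht =>
    abs_solution_le hF hm hε hr hw hw0 (h := fun t => 4 * a * max (t - t₀) 0 - 2 * a * t)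
      (by simp [ht₀]) (by positivity : (0 : ℝ) ≤ 2 * a) (fun u t hu hut ht => by
        have := hmax u t hut
        rw [abs_le]
        constructor <;> nlinarith) hZ ht
  have hb' : ∀ t ∈ Set.Icc 0 T, |Z' t| ≤ r + (r + 2 * a * ε) / m := fun t ht =>
    abs_solution_le hF hm hε hr hw hw0 (h := fun t => 0)
      rfl (by positivity : (0 : ℝ) ≤ 2 * a) (fun u t hu hut ht => by
        rw [sub_zero, abs_zero]
        have := sub_nonneg.2 hut
        positivity) (by simpa using hZ') ht
  have hle : ∀ t ∈ Set.Icc v₀ T, Z' t ≤ Z t := fun t ht => by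
    have ht₀T : t₀ ≤ T := by linarith [ht.1, ht.2]
    -- Up to `t₀` the downward pull opens a gap of at most `2aε/m`. Afterwards the upward push gains
    -- at net rate at least `a` until the lead reaches `aε/M`, so the time `ε(2/m + 1/M)` closes the
    -- gap.
    have e₁ := hZ'.sub_le_of_zero hF hm.le hε hZ (α := 0) (β := 2 * a) (B := 2 * a * ε / m)
      (by positivity) (by field_simp; exact le_rfl) le_rfl (by simp [ht₀])
      (fun u t hu hut ht => by
        have := hmax u t hut
        nlinarith) ⟨ht₀, ht₀T⟩
    have e₂ := hZ.le_sub hF hm.le hM.le hε hZ' (t₀ := t₀) (c := 2 * a * ε / m) (κ := 2 * a)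
      (α := 0) (θ := a * ε / M) ht₀ (by positivity) (by field_simp; exact le_rfl) (by linarith)
      (fun u t hu hut ht => by
        rw [max_eq_left (by linarith : 0 ≤ t - t₀), max_eq_left (by linarith : 0 ≤ u - t₀)]
        linarith) le_rfl (t := t) (by linarith [ht.1]) ht.2 (by
        have h1 : 2 * a * ε / m + a * ε / M = a * (ε * (2 / m + 1 / M)) := by field_simp
        rw [h1]
        have := ht.1
        nlinarith)
    have : 0 < a * ε / M := by positivity
    linarith
  obtain ⟨t, ht, hlt, hs⟩ := h
  have htv : v₀ ≤ t := by
    by_contra hc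
    push Not at hc
    have := (abs_le.1 (hb t ht)).1
    nlinarith
  refine ⟨t, ht, (hle t ⟨htv, ht.2⟩).trans_lt hlt, fun s hs' => ?_⟩
  have hsT : s ∈ Set.Icc 0 T := ⟨hs'.1, hs'.2.trans ht.2⟩
  rcases le_total s v₀ with h1 | h1
  · have := (abs_le.1 (hb' s hsT)).2
    nlinarith
  · exact (hle s ⟨h1, hsT.2⟩).trans (hs s hs')

/-- If the noise is small compared to the drift, the path does not reach the upper boundary. -/
lemma lt_of_small_noise (hF : IsDriftField F m M) (hm : 0 < m) (hM : 0 < M)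
    (hε : 0 < ε) (ha : 0 < a) (hr : 0 ≤ r) (hw : OscBound w ε T r) (hw0 : w 0 = 0)
    (hr1 : r ≤ a * ε / 2) (hr2 : r < a * ε / (4 * M)) (hsep : r + r / m < a * (T - ε / M))
    (hZ : IsForcedSolution F ε T (fun t => w t - a * t) Z) {t : ℝ} (ht : t ∈ Set.Icc 0 T) :
    Z t < a * (T - t) := by
  have hz := isForcedSolution_zero hF (ε := ε) (S := T)
  have hinc : ∀ u t, 0 ≤ u → u ≤ t → t ≤ T → |w t - w u| ≤ r + r / ε * (t - u) := by
    intro u t hu hut ht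
    have h1 := hw u t hu hut ht
    have h3 : r * (1 + (t - u) / ε) = r + r / ε * (t - u) := by ring
    linarith
  -- After time `ε / M` the drift has already pushed the path below zero; before that time the cone
  -- is still wider than the noise.
  rcases le_total (ε / M) t with h | h
  · have hrε : r / ε ≤ a / 2 := by
      rw [div_le_iff₀ hε]; linarith
    have e := hz.le_sub hF hm.le hM.le hε hZ (t₀ := 0) (c := 0) (κ := a / 2) (α := r)
      (θ := a * ε / (4 * M)) le_rfl (by positivity) (by field_simp; norm_num)
      (by
        have := hZ.eqn 0 ⟨le_rfl, ht.1.trans ht.2⟩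
        simp only [intervalIntegral.integral_same, hw0] at this
        simp [this])
      (fun u t hu hut ht => by
        have h1 := (abs_le.1 (hinc u t hu hut ht)).2
        have h2 := mul_le_mul_of_nonneg_right hrε (sub_nonneg.2 hut)
        linarith) hr ht.1 ht.2 (by
        have : a * ε / (4 * M) = a / 4 * (ε / M) := by field_simp
        rw [this]
        nlinarith)
    have : 0 ≤ a * (T - t) := mul_nonneg ha.le (by linarith [ht.2])
    linarith
  · have e := hZ.sub_le_of_zero hF hm.le hε hz (α := r) (β := r / ε) (B := r / m)
      (by positivity) (by field_simp; exact le_rfl) hr (by simp [hw0])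
      (fun u t hu hut ht => by
        have h1 := (abs_le.1 (hinc u t hu hut ht)).2
        nlinarith) ht
    have : a * (T - ε / M) ≤ a * (T - t) := by nlinarith
    linarith

end Paths

/-! ### The force near the bottom of the potential -/

lemma energyDeriv_eq {V : ℝ → ℝ} {a x t : ℝ} (h₁ : DifferentiableAt ℝ V x)
    (h₂ : DifferentiableAt ℝ V (2 * a * (1 + t) - x)) :
    energyDeriv V a x t = deriv V x - deriv V (2 * a * (1 + t) - x) := by
  have h₃ : HasDerivAt (fun z => V (2 * a * (1 + t) - z))
      (deriv V (2 * a * (1 + t) - x) * (-1)) x :=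
    h₂.hasDerivAt.comp x ((hasDerivAt_id x).const_sub _)
  have := (h₁.hasDerivAt.add h₃).deriv
  rw [mul_neg_one, ← sub_eq_add_neg] at this
  exact this

section Potential

variable {U : ℝ → ℝ} {a b a₀ u₀ : ℝ}

lemma IsChainPotential.differentiableAt (hU : IsChainPotential U a b a₀ u₀) {y : ℝ}
    (hy : y ∈ Set.Ioo 0 b) : DifferentiableAt ℝ U y :=
  (hU.contDiffOn.contDiffAt (Ioc_mem_nhds hy.1 hy.2)).differentiableAt (by norm_num)

/-- Near the bottom of the potential, the force coincides with a function on the real line whose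
slopes are bounded above and below. -/
lemma exists_regularized_force (hU : IsChainPotential U a b a₀ u₀) :
    ∃ κ > 0, ∃ M > 0, ∃ g : ℝ → ℝ,
      (∀ x y, x ≤ y → u₀ * (y - x) ≤ g y - g x ∧ g y - g x ≤ M * (y - x)) ∧
      ∀ y ∈ Set.Ioo (a - κ) b, deriv U y = g y := by
  have ha₀ := hU.a₀_mem
  have hab := hU.a_lt_b
  have hu := hU.u₀_pos
  have hb : 0 < b := hU.a_pos.trans hab
  set κ := (a - a₀) / 2 with hκ
  have hκ0 : 0 < κ := by rw [hκ]; linarith [ha₀.2]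
  set c := a - κ with hc
  have hca : a₀ < c := by rw [hc, hκ]; linarith [ha₀.2]
  have hc0 : 0 < c := ha₀.1.trans hca
  have hcb : c < b := by linarith
  have hsub : Set.Icc c b ⊆ Set.Ioc 0 b := fun y hy => ⟨hc0.trans_le hy.1, hy.2⟩
  have huniq : UniqueDiffOn ℝ (Set.Ioc 0 b) := uniqueDiffOn_Ioc 0 b
  set D := derivWithin U (Set.Ioc 0 b) with hD
  have hDeq : ∀ y ∈ Set.Ioo 0 b, D y = deriv U y := fun y hy =>
    derivWithin_of_mem_nhds (Ioc_mem_nhds hy.1 hy.2)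
  have hDC : ContDiffOn ℝ 2 D (Set.Ioc 0 b) := hU.contDiffOn.derivWithin huniq (by norm_num)
  have hD2 : ContinuousOn (derivWithin D (Set.Ioc 0 b)) (Set.Ioc 0 b) :=
    hDC.continuousOn_derivWithin huniq (by norm_num)
  obtain ⟨K, hK⟩ := (isCompact_Icc (a := c) (b := b)).exists_bound_of_continuousOn (hD2.mono hsub)
  have hK0 : 0 ≤ K := (norm_nonneg _).trans (hK c ⟨le_rfl, hcb.le⟩)
  have hDc : ContinuousOn D (Set.Icc c b) := hDC.continuousOn.mono hsub
  have hDd : DifferentiableOn ℝ D (interior (Set.Icc c b)) := by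
    rw [interior_Icc]
    intro y hy
    exact ((hDC.contDiffAt (Ioc_mem_nhds (hc0.trans hy.1) hy.2)).differentiableAt
      (by norm_num)).differentiableWithinAt
  have hup : ∀ x ∈ Set.Icc c b, ∀ y ∈ Set.Icc c b, x ≤ y → D y - D x ≤ K * (y - x) := by
    refine Convex.image_sub_le_mul_sub_of_deriv_le (convex_Icc c b) hDc hDd fun y hy => ?_
    rw [interior_Icc] at hy
    rw [← derivWithin_of_mem_nhds (Ioc_mem_nhds (hc0.trans hy.1) hy.2)]
    exact (Real.le_norm_self _).trans (hK y ⟨hy.1.le, hy.2.le⟩)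
  have hlo : ∀ x ∈ Set.Icc c b, ∀ y ∈ Set.Icc c b, x ≤ y → u₀ * (y - x) ≤ D y - D x := by
    refine Convex.mul_sub_le_image_sub_of_le_deriv (convex_Icc c b) hDc hDd fun y hy => ?_
    rw [interior_Icc] at hy
    have he : D =ᶠ[𝓝 y] deriv U := by
      filter_upwards [Ioo_mem_nhds (hc0.trans hy.1) hy.2] with v hv using hDeq v hv
    rw [he.deriv_eq]
    exact hU.convex y ⟨hca.trans hy.1, hy.2⟩
  -- Beyond `[c, b]` the force is continued linearly with slope `u₀`, so the convexity bound holds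
  -- globally; `M = K + u₀` covers both pieces.
  let p : ℝ → ℝ := fun y => max c (min b y)
  have hp : ∀ y, p y ∈ Set.Icc c b := fun y => ⟨le_max_left _ _, max_le hcb.le (min_le_left _ _)⟩
  have hpm : ∀ x y, x ≤ y → p x ≤ p y := fun x y h => max_le_max le_rfl (min_le_min le_rfl h)
  have hp1 : ∀ x y, x ≤ y → p y - p x ≤ y - x := fun x y h => by
    simp only [p]
    rcases min_cases b x with h1 | h1 <;> rcases min_cases b y with h2 | h2 <;>
    rcases max_cases c (min b x) with h3 | h3 <;>
    rcases max_cases c (min b y) with h4 | h4 <;> linarith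
  refine ⟨κ, hκ0, K + u₀, by linarith, fun y => D (p y) + u₀ * (y - p y), fun x y hxy => ?_,
    fun y hy => ?_⟩
  · have h1 := hup _ (hp x) _ (hp y) (hpm x y hxy)
    have h2 := hlo _ (hp x) _ (hp y) (hpm x y hxy)
    have h3 := hp1 x y hxy
    have h4 := hpm x y hxy
    constructor
    · linarith
    · nlinarith
  · have hpy : p y = y := by
      simp only [p]
      rw [min_eq_right hy.2.le, max_eq_right hy.1.le]
    simp only [hpy]
    rw [hDeq y ⟨hc0.trans hy.1, hy.2⟩]
    ring

/-- The drift of the distance to the midpoint, for a force `g`. -/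
def midDrift (g : ℝ → ℝ) (a t z : ℝ) : ℝ := g (a * (1 + t) + z) - g (a * (1 + t) - z)

lemma isDriftField_midDrift {g : ℝ → ℝ} {μ M : ℝ} (hμ : 0 ≤ μ) (a : ℝ)
    (hg : ∀ x y, x ≤ y → μ * (y - x) ≤ g y - g x ∧ g y - g x ≤ M * (y - x)) :
    IsDriftField (midDrift g a) (2 * μ) (2 * M) where
  continuous := by
    have hgc : Continuous g := by
      have hL : LipschitzWith (Real.toNNReal |M|) g := by
        refine LipschitzWith.of_dist_le_mul fun x y => ?_
        rw [Real.coe_toNNReal _ (abs_nonneg _), Real.dist_eq, Real.dist_eq, ← abs_mul]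
        rcases le_total x y with h | h
        · have h1 := hg x y h
          have h2 := mul_nonneg hμ (sub_nonneg.2 h)
          rw [abs_sub_comm, abs_of_nonneg (by linarith)]
          calc g y - g x ≤ M * (y - x) := h1.2
            _ = -(M * (x - y)) := by ring
            _ ≤ _ := neg_le_abs _
        · have h1 := hg y x h
          have h2 := mul_nonneg hμ (sub_nonneg.2 h)
          rw [abs_of_nonneg (by linarith)]
          exact h1.2.trans (le_abs_self _)
      exact hL.continuous
    unfold midDrift Function.uncurry
    fun_prop
  lower t x y hxy := by
    have h1 := (hg (a * (1 + t) + x) (a * (1 + t) + y) (by linarith)).1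
    have h2 := (hg (a * (1 + t) - y) (a * (1 + t) - x) (by linarith)).1
    simp only [midDrift]
    nlinarith
  upper t x y hxy := by
    have h1 := (hg (a * (1 + t) + x) (a * (1 + t) + y) (by linarith)).2
    have h2 := (hg (a * (1 + t) - y) (a * (1 + t) - x) (by linarith)).2
    simp only [midDrift]
    nlinarith
  odd t x := by simp only [midDrift, sub_neg_eq_add, ← sub_eq_add_neg]; ring

/-! ### The breaking time of a path -/

lemma notMem_of_eq_end (ha : 0 < a) (x : ℝ≥0 → ℝ) {t : ℝ≥0} (ht : (t : ℝ) = b / a - 1) :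
    x t ∉ Set.Ioo (2 * a * (1 + (t : ℝ)) - b) b := by
  rintro ⟨h1, h2⟩
  have : 2 * a * (1 + (b / a - 1)) - b = b := by field_simp; ring
  rw [ht] at h1
  linarith

lemma breakTime_le (ha : 0 < a) (hab : a < b) (x : ℝ≥0 → ℝ) :
    (breakTime a b x : ℝ) ≤ b / a - 1 := by
  have hT : 0 ≤ b / a - 1 := by
    rw [sub_nonneg, le_div_iff₀ ha]; linarith
  have : breakTime a b x ≤ ⟨b / a - 1, hT⟩ :=
    csInf_le (OrderBot.bddBelow _) (notMem_of_eq_end ha x rfl)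
  exact_mod_cast this

lemma breakTime_notMem (ha : 0 < a) (hab : a < b) {x : ℝ≥0 → ℝ} (hx : Continuous x) :
    x (breakTime a b x) ∉ Set.Ioo (2 * a * (1 + (breakTime a b x : ℝ)) - b) b := by
  have hcl : IsClosed {t : ℝ≥0 | x t ∉ Set.Ioo (2 * a * (1 + (t : ℝ)) - b) b} := by
    have : {t : ℝ≥0 | x t ∉ Set.Ioo (2 * a * (1 + (t : ℝ)) - b) b} =
        {t : ℝ≥0 | x t ≤ 2 * a * (1 + (t : ℝ)) - b} ∪ {t | b ≤ x t} := by
      ext t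
      simp only [Set.mem_Ioo, Set.mem_ofPred_eq, not_and_or, not_lt, Set.mem_union]
    rw [this]
    exact (isClosed_le hx (by fun_prop)).union (isClosed_le continuous_const hx)
  have hT : 0 ≤ b / a - 1 := by
    rw [sub_nonneg, le_div_iff₀ ha]; linarith
  exact hcl.csInf_mem ⟨⟨b / a - 1, hT⟩, notMem_of_eq_end ha x rfl⟩ (OrderBot.bddBelow _)

lemma mem_of_lt_breakTime {x : ℝ≥0 → ℝ} {t : ℝ≥0} (ht : t < breakTime a b x) :
    x t ∈ Set.Ioo (2 * a * (1 + (t : ℝ)) - b) b := by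
  by_contra h
  exact absurd (csInf_le (OrderBot.bddBelow _) h) (not_le.2 ht)

/-- As long as the solution `Z` of the equation with the regularized force is small, the path `x`
moves according to `Z` until the chain breaks. -/
lemma breakTime_of_solution (hU : IsChainPotential U a b a₀ u₀) {κ M : ℝ} {g : ℝ → ℝ}
    (hg : ∀ x y, x ≤ y → u₀ * (y - x) ≤ g y - g x ∧ g y - g x ≤ M * (y - x))
    (hgU : ∀ y ∈ Set.Ioo (a - κ) b, deriv U y = g y) {ε : ℝ} (hε : 0 < ε) {x : ℝ≥0 → ℝ}
    (hx : Continuous x) (hx0 : x 0 = a) {w Z : ℝ → ℝ}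
    (heqn : ∀ t : ℝ≥0, t ≤ breakTime a b x →
      x t = a + (∫ s in (0 : ℝ)..t, -(1 / ε) * energyDeriv U a (x s.toNNReal) s) + w t)
    (hZ : IsForcedSolution (midDrift g a) ε (b / a - 1) (fun t => w t - a * t) Z)
    (hZκ : ∀ t ∈ Set.Icc 0 (b / a - 1), |Z t| < κ) :
    0 < (breakTime a b x : ℝ) ∧
    (∀ s ∈ Set.Ico 0 (breakTime a b x : ℝ), |Z s| < a * (b / a - 1 - s)) ∧
    (x (breakTime a b x) = b ↔
      Z (breakTime a b x) = a * (b / a - 1 - breakTime a b x)) ∧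
    (x (breakTime a b x) ≠ b →
      Z (breakTime a b x) = -(a * (b / a - 1 - breakTime a b x))) := by
  have ha := hU.a_pos
  have hab := hU.a_lt_b
  have hb2 := hU.b_lt
  set τ := breakTime a b x with hτ
  have hτT : (τ : ℝ) ≤ b / a - 1 := breakTime_le ha hab x
  have hcone : ∀ s : ℝ, a * (b / a - 1 - s) = b - a * (1 + s) := fun s => by field_simp; ring
  have hτ0 : 0 < τ := by
    rw [pos_iff_ne_zero]
    intro h
    have := breakTime_notMem ha hab hx
    rw [← hτ, h, hx0] at this
    refine this ⟨?_, hab⟩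
    simp only [NNReal.coe_zero]
    linarith
  -- In the frame moving with the midpoint `a (1 + t)`, the forcing acquires the term `-a t`.
  let z : ℝ → ℝ := fun t => x t.toNNReal - a * (1 + t)
  have hzc : Continuous z := by fun_prop
  have hzs : ∀ s : ℝ, 0 ≤ s → s < τ → |z s| < a * (b / a - 1 - s) := fun s hs hsτ => by
    have h1 := mem_of_lt_breakTime (a := a) (b := b) (x := x) (t := s.toNNReal)
      (by rw [← hτ, ← NNReal.coe_lt_coe, Real.coe_toNNReal s hs]; exact hsτ)
    rw [Real.coe_toNNReal s hs] at h1
    rw [hcone, abs_lt]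
    simp only [z]
    constructor <;> linarith [h1.1, h1.2]
  have hF := isDriftField_midDrift hU.u₀_pos.le a hg
  have hforce : ∀ s : ℝ, 0 ≤ s → s < τ → |z s| < κ →
      energyDeriv U a (x s.toNNReal) s = midDrift g a s (z s) := fun s hs hsτ hsκ => by
    have h1 := abs_lt.1 (hzs s hs hsτ)
    have h2 := abs_lt.1 hsκ
    have h3 : 0 ≤ a * s := by positivity
    rw [hcone] at h1
    have e1 : x s.toNNReal = a * (1 + s) + z s := by simp only [z]; ring
    have e2 : 2 * a * (1 + s) - x s.toNNReal = a * (1 + s) - z s := by simp only [z]; ring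
    rw [energyDeriv_eq (hU.differentiableAt ?_) (hU.differentiableAt ?_), midDrift, e2, e1,
      hgU _ ?_, hgU _ ?_]
    · constructor <;> linarith
    · constructor <;> linarith
    · rw [e1]
      constructor <;> nlinarith
    · rw [e2]
      constructor <;> nlinarith
  have hsol : ∀ t₁ : ℝ, t₁ ≤ τ → (∀ s, 0 ≤ s → s < t₁ → |z s| < κ) →
      IsForcedSolution (midDrift g a) ε t₁ (fun t => w t - a * t) z := by
    intro t₁ ht₁ hs
    refine ⟨hzc, fun t ht => ?_⟩
    have h1 := heqn t.toNNReal
      (by rw [← NNReal.coe_le_coe, Real.coe_toNNReal t ht.1]; exact ht.2.trans ht₁)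
    rw [Real.coe_toNNReal t ht.1] at h1
    have h2 : ∫ s in (0 : ℝ)..t, -(1 / ε) * energyDeriv U a (x s.toNNReal) s =
        ∫ s in (0 : ℝ)..t, -(1 / ε) * midDrift g a s (z s) := by
      -- The endpoint is discarded: at the breaking time the path may sit at a point where `U` need
      -- not be differentiable.
      rw [intervalIntegral.integral_of_le ht.1, intervalIntegral.integral_of_le ht.1,
        integral_Ioc_eq_integral_Ioo, integral_Ioc_eq_integral_Ioo]
      refine setIntegral_congr_fun measurableSet_Ioo fun s hs' => ?_
      have hst : s < t₁ := hs'.2.trans_le ht.2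
      rw [hforce s hs'.1.le (hst.trans_le ht₁) (hs s hs'.1.le hst)]
    rw [h2, intervalIntegral.integral_const_mul] at h1
    simp only [z]
    rw [h1]
    ring
  have huniq : ∀ t₁ : ℝ, 0 ≤ t₁ → t₁ ≤ τ → (∀ s, 0 ≤ s → s < t₁ → |z s| < κ) → z t₁ = Z t₁ :=
    fun t₁ h0 ht₁ hs => (hsol t₁ ht₁ hs).unique hF (by linarith [hU.u₀_pos]) hε
      (hZ.mono (ht₁.trans hτT)) (fun _ _ => rfl) ⟨h0, le_rfl⟩
  -- Continuation argument: at the first time with `|z| ≥ κ`, uniqueness still gives `z = Z`,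
  -- contradicting `|Z| < κ`.
  have hsmall : ∀ s : ℝ, 0 ≤ s → s ≤ τ → |z s| < κ := by
    by_contra hc
    push Not at hc
    obtain ⟨s, hs0, hsτ, hsκ⟩ := hc
    have hK : IsCompact (Set.Icc 0 (τ : ℝ) ∩ {v | κ ≤ |z v|}) :=
      isCompact_Icc.inter_right (isClosed_le continuous_const hzc.abs)
    obtain ⟨t₁, ⟨ht₁, ht₁κ⟩, hmin⟩ := hK.exists_isLeast ⟨s, ⟨hs0, hsτ⟩, hsκ⟩
    have h1 := huniq t₁ ht₁.1 ht₁.2 fun v hv0 hv => by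
      by_contra hc
      exact absurd (hmin ⟨⟨hv0, hv.le.trans ht₁.2⟩, not_lt.1 hc⟩) (not_le.2 hv)
    have h2 := hZκ t₁ ⟨ht₁.1, ht₁.2.trans hτT⟩
    rw [← h1] at h2
    exact absurd h2 (not_lt.2 ht₁κ)
  have hzZ : ∀ s : ℝ, 0 ≤ s → s ≤ τ → z s = Z s := fun s hs0 hsτ =>
    huniq s hs0 hsτ fun v hv0 hv => hsmall v hv0 (hv.le.trans hsτ)
  have hzτ : z τ = x τ - a * (1 + τ) := by simp only [z, Real.toNNReal_coe]
  have hZτ := hzZ τ τ.2 le_rfl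
  refine ⟨by exact_mod_cast hτ0, fun s hs => ?_, ?_, fun hne => ?_⟩
  · rw [← hzZ s hs.1 hs.2.le]
    exact hzs s hs.1 hs.2
  · rw [← hZτ, hzτ, hcone]
    constructor <;> intro h <;> linarith
  · have hcl : ∀ s ∈ Set.Icc 0 (τ : ℝ), |z s| ≤ b - a * (1 + s) := by
      have hclosed : IsClosed {s | |z s| ≤ b - a * (1 + s)} :=
        isClosed_le hzc.abs (by fun_prop)
      have h0 : (0 : ℝ) ≠ τ := by
        have : (0 : ℝ) < τ := by exact_mod_cast hτ0
        exact this.ne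
      rw [← closure_Ico h0]
      refine hclosed.closure_subset_iff.2 fun s hs => ?_
      have := hzs s hs.1 hs.2
      rw [hcone] at this
      exact this.le
    have h1 := abs_le.1 (hcl τ ⟨τ.2, le_rfl⟩)
    have h2 := breakTime_notMem ha hab hx
    rw [← hτ, Set.mem_Ioo, not_and_or, not_lt, not_lt] at h2
    rw [← hZτ, hcone]
    rcases h2 with h2 | h2
    · linarith
    · exact absurd (le_antisymm (by linarith) h2) hne

end Potential

/-! ### Maximal inequalities for Brownian motion -/

lemma half_le_gaussianReal_Ici (v : ℝ≥0) : 1 / 2 ≤ (gaussianReal 0 v).real (Set.Ici 0) := by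
  have h1 : (gaussianReal 0 v).real (Set.Iic 0) = (gaussianReal 0 v).real (Set.Ici 0) := by
    have h := gaussianReal_map_neg (μ := 0) (v := v)
    rw [neg_zero] at h
    rw [← h, map_measureReal_apply measurable_neg measurableSet_Iic,
      h]
    congr 1
    ext x
    simp
  have h2 : (gaussianReal 0 v).real Set.univ ≤
      (gaussianReal 0 v).real (Set.Iic 0) + (gaussianReal 0 v).real (Set.Ici 0) := by
    rw [← Set.Iic_union_Ici (a := (0 : ℝ))]
    exact measureReal_union_le _ _
  rw [probReal_univ] at h2
  linarith

section

variable {Ω : Type*} [MeasurableSpace Ω] {P : Measure Ω} {B : ℝ≥0 → Ω → ℝ}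

lemma measureReal_lt_le_exp (hB : IsPreBrownianReal B P) (h : ℝ≥0) {x : ℝ} (hx : 0 ≤ x) :
    P.real {ω | x < B h ω} ≤ Real.exp (-x ^ 2 / (2 * h)) := by
  have := hB.isGaussianProcess.isProbabilityMeasure
  have hlaw := hB.hasLaw_eval h
  have hsub : HasSubgaussianMGF (B h) h P := by
    refine ⟨fun t => ?_, fun t => ?_⟩
    · have h1 := integrable_exp_mul_gaussianReal (μ := 0) (v := h) t
      rw [← hlaw.map_eq] at h1
      exact (integrable_map_measure h1.aestronglyMeasurable hlaw.aemeasurable).1 h1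
    · rw [mgf_gaussianReal hlaw.map_eq]
      simp
  exact (measureReal_mono (fun ω (hω : x < B h ω) => hω.le) (measure_ne_top _ _)).trans (hsub.measure_ge_le hx)

/-- Lévy's inequality: the maximum over finitely many times is controlled by the last value. -/
lemma measureReal_exists_lt_le (hB : IsPreBrownianReal B P) {t : ℕ → ℝ≥0} (ht : Monotone t)
    (n : ℕ) (x : ℝ) :
    P.real {ω | ∃ k ≤ n, x < B (t k) ω} ≤ 2 * P.real {ω | x < B (t n) ω} := by
  have := hB.isGaussianProcess.isProbabilityMeasure
  let A : ℕ → Set Ω := fun k => {ω | x < B (t k) ω ∧ ∀ j < k, B (t j) ω ≤ x}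
  let C : ℕ → Set Ω := fun k => {ω | 0 ≤ B (t n) ω - B (t k) ω}
  have hmeas : ∀ k, NullMeasurableSet {ω | x < B (t k) ω} P := fun k =>
    nullMeasurableSet_lt aemeasurable_const (hB.aemeasurable _)
  have hAm : ∀ k, NullMeasurableSet (A k) P := fun k => by
    have : A k = {ω | x < B (t k) ω} ∩ ⋂ j, ⋂ (_ : j < k), {ω | B (t j) ω ≤ x} := by
      ext ω; simp [A]
    rw [this]
    exact (hmeas k).inter (NullMeasurableSet.iInter fun j => NullMeasurableSet.iInter fun _ =>
      nullMeasurableSet_le (hB.aemeasurable _) aemeasurable_const)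
  have hCm : ∀ k, NullMeasurableSet (C k) P := fun k =>
    nullMeasurableSet_le aemeasurable_const ((hB.aemeasurable _).sub (hB.aemeasurable _))
  -- `A k` is the event of a first exceedance at index `k`, and `C k` says that the later increment
  -- is nonnegative. They are independent, and `C k` has probability at least one half by symmetry.
  have hhalf : ∀ k ∈ Finset.range (n + 1), P.real (A k) ≤ 2 * P.real (A k ∩ C k) := by
    intro k hk
    have hkn : t k ≤ t n := ht (Nat.lt_succ_iff.1 (Finset.mem_range.1 hk))
    have hind := hB.indepFun_shift (t k)
    let SA : Set (Set.Iic (t k) → ℝ) :=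
      {f | x < f ⟨t k, Set.mem_Iic.2 le_rfl⟩} ∩ ⋂ j, ⋂ (hj : j < k), {f | f ⟨t j, ht hj.le⟩ ≤ x}
    let SC : Set (ℝ≥0 → ℝ) := {f | 0 ≤ f (t n - t k)}
    have hSA : MeasurableSet SA :=
      (measurableSet_lt measurable_const (measurable_pi_apply _)).inter
        (MeasurableSet.iInter fun j => MeasurableSet.iInter fun _ =>
          measurableSet_le (measurable_pi_apply _) measurable_const)
    have hSC : MeasurableSet SC := measurableSet_le measurable_const (measurable_pi_apply _)
    have h1 := hind.measure_inter_preimage_eq_mul SC SA hSC hSA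
    have hA : (fun ω (s : Set.Iic (t k)) => B s ω) ⁻¹' SA = A k := by
      ext ω; simp [A, SA]
    have hC : (fun ω s => B (t k + s) ω - B (t k) ω) ⁻¹' SC = C k := by
      ext ω; simp [C, SC, add_tsub_cancel_of_le hkn]
    rw [hA, hC, Set.inter_comm] at h1
    have h2 : P.real (A k ∩ C k) = P.real (C k) * P.real (A k) := by
      simp only [measureReal_def, h1, ENNReal.toReal_mul]
    have h3 : 1 / 2 ≤ P.real (C k) := by
      have hl := hB.hasLaw_sub (t n) (t k)
      have : C k = (B (t n) - B (t k)) ⁻¹' Set.Ici 0 := rfl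
      rw [this, ← map_measureReal_apply_of_aemeasurable hl.aemeasurable measurableSet_Ici, hl.map_eq]
      exact half_le_gaussianReal_Ici _
    rw [h2]
    nlinarith [measureReal_nonneg (μ := P) (s := A k)]
  have hcover : {ω | ∃ k ≤ n, x < B (t k) ω} ⊆ ⋃ k ∈ Finset.range (n + 1), A k := by
    rintro ω ⟨k, hk, hx⟩
    classical
    have hex : ∃ k, x < B (t k) ω := ⟨k, hx⟩
    have hle : Nat.find hex ≤ k := Nat.find_min' hex hx
    simp only [Set.mem_iUnion, Finset.mem_range]
    exact ⟨Nat.find hex, by omega, Nat.find_spec hex, fun j hj => not_lt.1 (Nat.find_min hex hj)⟩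
  have hdisj : Set.Pairwise (↑(Finset.range (n + 1)) : Set ℕ)
      (Function.onFun (AEDisjoint P) fun k => A k ∩ C k) := by
    intro i _ j _ hij
    refine Disjoint.aedisjoint (Set.disjoint_left.2 fun ω hi hj => ?_)
    rcases lt_or_gt_of_ne hij with h | h
    · exact absurd hi.1.1 (not_lt.2 (hj.1.2 i h))
    · exact absurd hj.1.1 (not_lt.2 (hi.1.2 j h))
  calc P.real {ω | ∃ k ≤ n, x < B (t k) ω}
      ≤ P.real (⋃ k ∈ Finset.range (n + 1), A k) := measureReal_mono hcover (measure_ne_top _ _)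
    _ ≤ ∑ k ∈ Finset.range (n + 1), P.real (A k) := measureReal_biUnion_finset_le _ _
    _ ≤ ∑ k ∈ Finset.range (n + 1), 2 * P.real (A k ∩ C k) := Finset.sum_le_sum hhalf
    _ = 2 * P.real (⋃ k ∈ Finset.range (n + 1), A k ∩ C k) := by
      rw [← Finset.mul_sum, measureReal_biUnion_finset₀ hdisj
        fun k _ => (hAm k).inter (hCm k)]
    _ ≤ 2 * P.real {ω | x < B (t n) ω} := by
      refine mul_le_mul_of_nonneg_left (measureReal_mono (fun ω hω => ?_) (measure_ne_top _ _))
        zero_le_two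
      simp only [Set.mem_iUnion] at hω
      obtain ⟨k, _, hA, hC⟩ := hω
      have h1 : x < B (t k) ω := hA.1
      have h2 : 0 ≤ B (t n) ω - B (t k) ω := hC
      simp only [Set.mem_ofPred_eq]
      linarith

/-- The finite maximal inequality is applied on dyadic grids, which are nested; by path continuity,
exceeding an open level is seen on some grid. -/
lemma measureReal_exists_lt_le_exp (hB : IsBrownianReal B P) (h : ℝ≥0) {x : ℝ} (hx : 0 ≤ x) :
    P.real {ω | ∃ t ≤ h, x < B t ω} ≤ 2 * Real.exp (-x ^ 2 / (2 * h)) := by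
  have := hB.isGaussianProcess.isProbabilityMeasure
  let τ : ℕ → ℕ → ℝ≥0 := fun j k => h * (k / 2 ^ j)
  let E : ℕ → Set Ω := fun j => {ω | ∃ k ≤ 2 ^ j, x < B (τ j k) ω}
  have hE : ∀ j, P.real (E j) ≤ 2 * Real.exp (-x ^ 2 / (2 * h)) := fun j => by
    have hmono : Monotone (τ j) := fun k l hkl => by
      simp only [τ]
      gcongr
    have h1 := measureReal_exists_lt_le hB.toIsPreBrownianReal hmono (2 ^ j) x
    have h2 : τ j (2 ^ j) = h := by
      simp [τ]
    rw [h2] at h1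
    have h3 := measureReal_lt_le_exp hB.toIsPreBrownianReal h hx
    exact h1.trans (by linarith)
  have hEm : Monotone E := by
    refine monotone_nat_of_le_succ fun j ω => ?_
    rintro ⟨k, hk, hlt⟩
    refine ⟨2 * k, by rw [pow_succ]; omega, ?_⟩
    have : τ (j + 1) (2 * k) = τ j k := by
      simp only [τ]
      push_cast
      rw [pow_succ]
      congr 1
      field_simp
    rwa [this]
  have hsub : {ω | ∃ t ≤ h, x < B t ω} ≤ᵐ[P] ⋃ j, E j := by
    filter_upwards [hB.cont] with ω hc
    rintro ⟨t, hth, hlt⟩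
    rcases eq_or_ne h 0 with h0 | h0
    · refine Set.mem_iUnion.2 ⟨0, 0, by simp, ?_⟩
      have : t = 0 := le_antisymm (hth.trans_eq h0) zero_le
      simpa [τ, h0, this] using hlt
    have hlim : Tendsto (fun j : ℕ => τ j ⌊(t / h) * 2 ^ j⌋₊) atTop (𝓝 t) := by
      have h1 : Tendsto (fun j : ℕ => (2 : ℝ) ^ j) atTop atTop :=
        tendsto_pow_atTop_atTop_of_one_lt (by norm_num)
      have h2 := (tendsto_nat_floor_mul_div_atTop (t / h : ℝ≥0).2).comp h1
      have h3 := h2.const_mul (h : ℝ)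
      have h4 : (h : ℝ) * ((t / h : ℝ≥0) : ℝ) = t := by
        rw [← NNReal.coe_mul, mul_div_cancel₀ _ h0]
      change Tendsto _ _ (𝓝 ((h : ℝ) * ((t / h : ℝ≥0) : ℝ))) at h3
      rw [h4] at h3
      rw [← NNReal.tendsto_coe]
      refine h3.congr fun j => ?_
      simp only [τ, Function.comp_apply]
      push_cast
      congr 3
    have hev := ((hc.tendsto t).comp hlim).eventually (lt_mem_nhds hlt)
    obtain ⟨j, hj⟩ := hev.exists
    refine Set.mem_iUnion.2 ⟨j, ⌊(t / h) * 2 ^ j⌋₊, ?_, hj⟩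
    refine Nat.floor_le_of_le ?_
    push_cast
    exact mul_le_of_le_one_left zero_le (div_le_one_of_le₀ hth zero_le)
  have h1 : P.real {ω | ∃ t ≤ h, x < B t ω} ≤ P.real (⋃ j, E j) :=
    ENNReal.toReal_mono (measure_ne_top _ _) (measure_mono_ae hsub)
  refine h1.trans ?_
  rw [measureReal_def, hEm.measure_iUnion]
  refine ENNReal.toReal_le_of_le_ofReal (by positivity) (iSup_le fun j => ?_)
  rw [← ENNReal.ofReal_toReal (measure_ne_top P (E j))]
  exact ENNReal.ofReal_le_ofReal (hE j)

lemma measureReal_exists_lt_abs_le_exp (hB : IsBrownianReal B P) (h : ℝ≥0) {x : ℝ} (hx : 0 ≤ x) :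
    P.real {ω | ∃ t ≤ h, x < |B t ω|} ≤ 4 * Real.exp (-x ^ 2 / (2 * h)) := by
  have := hB.isGaussianProcess.isProbabilityMeasure
  have h1 := measureReal_exists_lt_le_exp hB h hx
  have h2 := measureReal_exists_lt_le_exp hB.neg h hx
  have h3 : {ω | ∃ t ≤ h, x < |B t ω|} ⊆
      {ω | ∃ t ≤ h, x < B t ω} ∪ {ω | ∃ t ≤ h, x < (-B) t ω} := by
    rintro ω ⟨t, ht, hlt⟩
    rcases lt_abs.1 hlt with h | h
    · exact Or.inl ⟨t, ht, h⟩
    · exact Or.inr ⟨t, ht, h⟩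
  have h4 := (measureReal_mono (μ := P) h3 (measure_ne_top _ _)).trans (measureReal_union_le _ _)
  linarith

/-- Between `u` and `t` there are at most `(t - u)/ε + 1` block steps, and the two partial end
blocks cost `2 y` more; this gives the factor `3`. -/
lemma oscBound_of_blocks {w : ℝ → ℝ} {ε T y : ℝ} (hε : 0 < ε) (hy : 0 ≤ y)
    (h : ∀ k ≤ ⌊T / ε⌋₊, ∀ s ∈ Set.Icc 0 ε, |w (k * ε + s) - w (k * ε)| ≤ y) :
    OscBound w ε T (3 * y) := by
  have hblock : ∀ t, 0 ≤ t → t ≤ T → |w t - w (⌊t / ε⌋₊ * ε)| ≤ y := by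
    intro t ht htT
    have h0 : 0 ≤ t / ε := by positivity
    have h1 := Nat.floor_le h0
    have h2 := (Nat.lt_floor_add_one (t / ε)).le
    rw [le_div_iff₀ hε] at h1
    rw [div_le_iff₀ hε] at h2
    have := h ⌊t / ε⌋₊ (Nat.floor_le_floor (by gcongr)) (t - ⌊t / ε⌋₊ * ε)
      ⟨by linarith, by linarith⟩
    rwa [add_sub_cancel] at this
  have hsum : ∀ j k : ℕ, j + k ≤ ⌊T / ε⌋₊ + 1 → |w ((j + k : ℕ) * ε) - w (j * ε)| ≤ k * y := by
    intro j k
    induction k with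
    | zero => intro _; simp
    | succ k ih =>
      intro hk
      have h1 := ih (by omega)
      have h2 := h (j + k) (by omega) ε ⟨hε.le, le_rfl⟩
      have h3 : ((j + (k + 1) : ℕ) : ℝ) * ε = ((j + k : ℕ) : ℝ) * ε + ε := by push_cast; ring
      rw [h3]
      calc _ = |(w (((j + k : ℕ) : ℝ) * ε + ε) - w (((j + k : ℕ) : ℝ) * ε)) +
            (w (((j + k : ℕ) : ℝ) * ε) - w (j * ε))| := by congr 1; ring
        _ ≤ y + k * y := (abs_add_le _ _).trans (add_le_add h2 h1)
        _ = _ := by push_cast; ring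
  intro u t hu hut htT
  have h1 := hblock u hu (hut.trans htT)
  have h2 := hblock t (hu.trans hut) htT
  have hjk : ⌊u / ε⌋₊ ≤ ⌊t / ε⌋₊ := Nat.floor_le_floor (by gcongr)
  obtain ⟨k, hk⟩ := Nat.exists_eq_add_of_le hjk
  have h3 := hsum ⌊u / ε⌋₊ k (by
    rw [← hk]
    exact (Nat.floor_le_floor (by gcongr)).trans (Nat.le_succ _))
  rw [← hk] at h3
  have h4 : (k : ℝ) ≤ (t - u) / ε + 1 := by
    have e1 := Nat.floor_le (show 0 ≤ t / ε by have := hu.trans hut; positivity)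
    have e2 := (Nat.lt_floor_add_one (u / ε)).le
    rw [hk] at e1
    push_cast at e1
    rw [sub_div]
    linarith
  have h5 : |w t - w u| ≤ y + k * y + y := by
    calc _ = |(w t - w (⌊t / ε⌋₊ * ε)) + (w (⌊t / ε⌋₊ * ε) - w (⌊u / ε⌋₊ * ε)) -
          (w u - w (⌊u / ε⌋₊ * ε))| := by congr 1; ring
      _ ≤ _ := (abs_sub _ _).trans (add_le_add ((abs_add_le _ _).trans (add_le_add h2 h3)) h1)
  have h6 : 0 ≤ (t - u) / ε := div_nonneg (sub_nonneg.2 hut) hε.le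
  nlinarith

lemma measureReal_not_oscBound_le (hB : IsBrownianReal B P) {ε T y : ℝ} (hε : 0 < ε)
    (hT : 0 ≤ T) (hy : 0 ≤ y) :
    P.real {ω | ¬ OscBound (fun t => B t.toNNReal ω) ε T (3 * y)} ≤
      (T / ε + 1) * (4 * Real.exp (-y ^ 2 / (2 * ε))) := by
  have := hB.isGaussianProcess.isProbabilityMeasure
  let E : ℕ → Set Ω := fun k =>
    {ω | ∃ t ≤ ε.toNNReal, y < |B ((k * ε).toNNReal + t) ω - B (k * ε).toNNReal ω|}
  have hE : ∀ k, P.real (E k) ≤ 4 * Real.exp (-y ^ 2 / (2 * ε)) := fun k => by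
    have := measureReal_exists_lt_abs_le_exp (hB.shift (k * ε).toNNReal) ε.toNNReal hy
    rwa [Real.coe_toNNReal _ hε.le] at this
  have hsub : {ω | ¬ OscBound (fun t => B t.toNNReal ω) ε T (3 * y)} ⊆
      ⋃ k ∈ Finset.range (⌊T / ε⌋₊ + 1), E k := by
    intro ω hω
    by_contra hc
    refine hω (oscBound_of_blocks hε hy fun k hk s hs => ?_)
    simp only [Set.mem_iUnion, not_exists, Finset.mem_range] at hc
    have h1 := hc k (by omega)
    simp only [E, Set.mem_ofPred_eq, not_exists, not_and, not_lt] at h1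
    have h2 := h1 s.toNNReal (Real.toNNReal_le_toNNReal hs.2)
    rwa [← Real.toNNReal_add (by positivity) hs.1] at h2
  calc _ ≤ P.real (⋃ k ∈ Finset.range (⌊T / ε⌋₊ + 1), E k) := measureReal_mono hsub (measure_ne_top _ _)
    _ ≤ ∑ k ∈ Finset.range (⌊T / ε⌋₊ + 1), P.real (E k) := measureReal_biUnion_finset_le _ _
    _ ≤ ∑ k ∈ Finset.range (⌊T / ε⌋₊ + 1), 4 * Real.exp (-y ^ 2 / (2 * ε)) :=
      Finset.sum_le_sum fun k _ => hE k
    _ = (⌊T / ε⌋₊ + 1 : ℝ) * (4 * Real.exp (-y ^ 2 / (2 * ε))) := by simp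
    _ ≤ _ := by
      gcongr
      exact Nat.floor_le (by positivity)

end

/-! ### The effect of a deterministic shift on the law of Brownian motion -/

/-- The `L¹`-distance between the standard normal density and its translate by `s`. -/
def gaussianShiftDist (s : ℝ) : ℝ := ∫ x, |gaussianPDFReal 0 1 x - gaussianPDFReal s 1 x|

lemma gaussianShiftDist_nonneg (s : ℝ) : 0 ≤ gaussianShiftDist s :=
  integral_nonneg fun _ => abs_nonneg _

/-- The bound is uniform in `D`, so it may be integrated over the independent component of Brownian
motion. -/
lemma gaussianReal_le_add_shiftDist (s : ℝ) (D : Set ℝ) :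
    gaussianReal 0 1 D ≤ gaussianReal s 1 D + ENNReal.ofReal (gaussianShiftDist s) := by
  have i₀ := integrable_gaussianPDFReal 0 1
  have i₁ := integrable_gaussianPDFReal s 1
  rw [gaussianReal_apply_eq_integral 0 one_ne_zero, gaussianReal_apply_eq_integral s one_ne_zero,
    ← ENNReal.ofReal_add (integral_nonneg fun _ => gaussianPDFReal_nonneg _ _ _)
      (gaussianShiftDist_nonneg s)]
  refine ENNReal.ofReal_le_ofReal ?_
  have h1 : ∫ x in D, (gaussianPDFReal 0 1 x - gaussianPDFReal s 1 x) ≤ gaussianShiftDist s :=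
    calc _ ≤ ∫ x in D, |gaussianPDFReal 0 1 x - gaussianPDFReal s 1 x| :=
          integral_mono (i₀.sub i₁).integrableOn (i₀.sub i₁).abs.integrableOn
            fun _ => le_abs_self _
      _ ≤ _ := setIntegral_le_integral (i₀.sub i₁).abs (ae_of_all _ fun _ => abs_nonneg _)
  rw [integral_sub i₀.integrableOn i₁.integrableOn] at h1
  linarith

lemma tendsto_gaussianShiftDist : Tendsto gaussianShiftDist (𝓝 0) (𝓝 0) := by
  have hpdf : ∀ s x : ℝ, gaussianPDFReal s 1 x =
      (√(2 * Real.pi))⁻¹ * Real.exp (-(x - s) ^ 2 / 2) := fun s x => by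
    simp [gaussianPDFReal]
  have h0 : (0 : ℝ) = ∫ _ : ℝ, (0 : ℝ) := by simp
  rw [h0]
  unfold gaussianShiftDist
  rw [← h0]
  have hint : Integrable fun x : ℝ =>
      2 * ((√(2 * Real.pi))⁻¹ * (Real.exp 1 * Real.exp (-(1 / 4) * x ^ 2))) :=
    (((integrable_exp_neg_mul_sq (by norm_num)).const_mul _).const_mul _).const_mul _
  have key := tendsto_integral_filter_of_dominated_convergence (μ := volume) (l := 𝓝 (0 : ℝ))
    (F := fun s x => |gaussianPDFReal 0 1 x - gaussianPDFReal s 1 x|) (f := fun _ => 0)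
    _ ?_ ?_ hint ?_
  · simpa using key
  · refine Eventually.of_forall fun s => ?_
    exact ((measurable_gaussianPDFReal 0 1).sub
      (measurable_gaussianPDFReal s 1)).abs.aestronglyMeasurable
  · filter_upwards [Metric.ball_mem_nhds (0 : ℝ) one_pos] with s hs
    rw [Metric.mem_ball, dist_zero_right, Real.norm_eq_abs] at hs
    have hs2 : s ^ 2 ≤ 1 := by rw [← sq_abs]; nlinarith [abs_nonneg s]
    refine ae_of_all _ fun x => ?_
    rw [Real.norm_eq_abs, abs_abs, hpdf, hpdf]
    -- Completing the square in `x - 2u` gives a Gaussian majorant valid for all shifts of size at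
    -- most one.
    have hb : ∀ u : ℝ, u ^ 2 ≤ 1 →
        Real.exp (-(x - u) ^ 2 / 2) ≤ Real.exp 1 * Real.exp (-(1 / 4) * x ^ 2) := fun u hu => by
      rw [← Real.exp_add]
      refine Real.exp_le_exp.2 ?_
      nlinarith [sq_nonneg (x - 2 * u)]
    refine (abs_sub _ _).trans ((add_le_add ?_ ?_).trans_eq (two_mul _).symm)
    · rw [abs_of_nonneg (by positivity)]
      exact mul_le_mul_of_nonneg_left (hb 0 (by norm_num)) (by positivity)
    · rw [abs_of_nonneg (by positivity)]
      exact mul_le_mul_of_nonneg_left (hb s hs2) (by positivity)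
  · refine ae_of_all _ fun x => ?_
    have hc : Continuous fun s => |gaussianPDFReal 0 1 x - gaussianPDFReal s 1 x| := by
      simp only [hpdf]
      fun_prop
    simpa using hc.tendsto 0

section

variable {Ω : Type*} [MeasurableSpace Ω] {P : Measure Ω} {B B' : ℝ≥0 → Ω → ℝ}
  {Q : Type*} [Countable Q] (τ : Q → ℝ≥0)

lemma aemeasurable_sample (hB : IsPreBrownianReal B P) :
    AEMeasurable (fun ω (q : Q) => B (τ q) ω) P :=
  aemeasurable_pi_lambda _ fun _ => hB.aemeasurable _

/-- Brownian motions have the same law along countably many times. -/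
lemma map_sample_eq (hB : IsPreBrownianReal B P) (hB' : IsPreBrownianReal B' P) :
    P.map (fun ω (q : Q) => B (τ q) ω) = P.map (fun ω (q : Q) => B' (τ q) ω) := by
  classical
  have := hB.isGaussianProcess.isProbabilityMeasure
  rw [map_eq_iff_forall_finset_map_restrict_eq (X := fun q => B (τ q)) (Y := fun q => B' (τ q))
    (aemeasurable_sample τ hB) (aemeasurable_sample τ hB')]
  intro I
  -- The times `τ q` may repeat, so the finite-dimensional law is taken on the set of distinct times
  -- and pulled back.
  let φ : (↥(I.image τ) → ℝ) → (I → ℝ) :=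
    fun f q => f ⟨τ q, Finset.mem_image_of_mem τ q.2⟩
  have hφ : Measurable φ := measurable_pi_lambda _ fun _ => measurable_pi_apply _
  have h1 := (hB.hasLaw (I.image τ)).map_eq
  have h2 := (hB'.hasLaw (I.image τ)).map_eq
  have e1 : P.map (fun ω => I.restrict fun q => B (τ q) ω) =
      (P.map fun ω => (I.image τ).restrict fun t => B t ω).map φ := by
    rw [AEMeasurable.map_map_of_aemeasurable hφ.aemeasurable (hB.hasLaw _).aemeasurable]
    rfl
  have e2 : P.map (fun ω => I.restrict fun q => B' (τ q) ω) =
      (P.map fun ω => (I.image τ).restrict fun t => B' t ω).map φ := by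
    rw [AEMeasurable.map_map_of_aemeasurable hφ.aemeasurable (hB'.hasLaw _).aemeasurable]
    rfl
  rw [e1, e2, h1, h2]

/-- The shape of the shift: linear between `t₀` and `T`, constant otherwise. -/
def ramp (t₀ T t : ℝ≥0) : ℝ := ((min t T : ℝ≥0) - (min t t₀ : ℝ≥0)) / √(T - t₀)

/-- An elementary substitute for Girsanov's theorem: `B = Y + ramp · N`, with `N` the normalised
increment over `[t₀, T]` and `Y` independent of it. Adding `s · ramp` to `B` only translates the
standard normal `N` by `s`. -/
lemma measure_sample_le_shift (hB : IsPreBrownianReal B P) {t₀ T : ℝ≥0} (hT : t₀ < T) (s : ℝ)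
    {A : Set (Q → ℝ)} (hA : MeasurableSet A) :
    P {ω | (fun q => B (τ q) ω) ∈ A} ≤
      P {ω | (fun q => B (τ q) ω + s * ramp t₀ T (τ q)) ∈ A} +
        ENNReal.ofReal (gaussianShiftDist s) := by
  classical
  have := hB.isGaussianProcess.isProbabilityMeasure
  have hd : (0 : ℝ) < T - t₀ := sub_pos.2 (by exact_mod_cast hT)
  set d := √((T : ℝ) - t₀) with hd_def
  have hd0 : 0 < d := Real.sqrt_pos.2 hd
  have hdd : d * d = T - t₀ := Real.mul_self_sqrt hd.le
  let N : Ω → ℝ := fun ω => d⁻¹ * (B T ω - B t₀ ω)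
  let Y : Q → Ω → ℝ := fun q ω => B (τ q) ω - ramp t₀ T (τ q) * N ω
  have hlin : ∀ t, MemLp (B t) 2 P := fun t => (hB.isGaussianProcess.hasGaussianLaw_eval t).memLp_two
  have hNm : AEMeasurable N P := ((hB.aemeasurable T).sub (hB.aemeasurable t₀)).const_mul _
  have hYm : ∀ q, AEMeasurable (Y q) P := fun q => (hB.aemeasurable _).sub (hNm.const_mul _)
  have hN2 : MemLp N 2 P := ((hlin T).sub (hlin t₀)).const_mul _
  have hG : IsGaussianProcess (Sum.elim Y fun _ : Unit => N) P := by
    refine hB.isGaussianProcess.of_isGaussianProcess ?_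
    rintro (q | u)
    · exact ⟨{τ q, T, t₀},
        { toFun x := x ⟨τ q, by simp⟩ - ramp t₀ T (τ q) *
            (d⁻¹ * (x ⟨T, by simp⟩ - x ⟨t₀, by simp⟩))
          map_add' x y := by simp; ring
          map_smul' c x := by simp; ring }, by simp [Y, N]⟩
    · exact ⟨{T, t₀},
        { toFun x := d⁻¹ * (x ⟨T, by simp⟩ - x ⟨t₀, by simp⟩)
          map_add' x y := by simp; ring
          map_smul' c x := by simp; ring }, by simp [N]⟩
  have hcovB : ∀ t, cov[B t, N; P] = ramp t₀ T t := fun t => by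
    simp only [N]
    rw [covariance_const_mul_right, covariance_fun_sub_right (hlin _) (hlin _) (hlin _),
      hB.covariance_eval, hB.covariance_eval, ramp, ← hd_def]
    field_simp
  have hvarN : cov[N, N; P] = 1 := by
    have : cov[N, N; P] = d⁻¹ * (ramp t₀ T T - ramp t₀ T t₀) := by
      conv_lhs => enter [1]
      simp only [N]
      rw [covariance_const_mul_left, covariance_fun_sub_left (hlin _) (hlin _) hN2, hcovB, hcovB]
    rw [this]
    simp only [ramp, ← hd_def, min_self, min_eq_left hT.le, min_eq_right hT.le]
    field_simp
    linarith
  -- `ramp t₀ T t` is the covariance of `B t` and `N`, so `Y` and `N` are uncorrelated; being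
  -- jointly Gaussian, they are independent.
  have hind : IndepFun (fun ω q => Y q ω) N P := by
    have h := hG.indepFun_of_covariance_eq_zero hYm (fun _ => hNm) fun q _ => by
      simp only [Y]
      rw [covariance_fun_sub_left (hlin _) (hN2.const_mul _) hN2, covariance_const_mul_left, hvarN,
        hcovB]
      ring
    exact h.comp measurable_id (measurable_pi_apply ())
  have hlawN : P.map N = gaussianReal 0 1 := by
    have h1 : HasGaussianLaw N P := hG.hasGaussianLaw_eval (Sum.inr ())
    have hmean : P[N] = 0 := by
      simp only [N]
      rw [integral_const_mul, integral_sub (hB.integrable_eval _) (hB.integrable_eval _),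
        hB.integral_eval, hB.integral_eval]
      simp
    rw [h1.map_eq_gaussianReal, hmean, ← covariance_self hNm, hvarN, Real.toNNReal_one]
  have hYm' : AEMeasurable (fun ω q => Y q ω) P := aemeasurable_pi_lambda _ hYm
  have hpair := (indepFun_iff_map_prod_eq_prod_map_map hYm' hNm).1 hind
  rw [hlawN] at hpair
  let Φ : ℝ → (Q → ℝ) × ℝ → (Q → ℝ) := fun r p q => p.1 q + (p.2 + r) * ramp t₀ T (τ q)
  have hΦ : ∀ r, Measurable (Φ r) := fun r => measurable_pi_lambda _ fun q => by
    simp only [Φ]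
    fun_prop
  have hrep : ∀ r, P {ω | (fun q => B (τ q) ω + r * ramp t₀ T (τ q)) ∈ A} =
      ∫⁻ y, gaussianReal 0 1 (Prod.mk y ⁻¹' (Φ r ⁻¹' A)) ∂(P.map fun ω q => Y q ω) := fun r => by
    rw [← Measure.prod_apply (hΦ r hA), ← hpair,
      Measure.map_apply_of_aemeasurable (hYm'.prodMk hNm) (hΦ r hA)]
    congr 1
    ext ω
    simp only [Set.mem_ofPred_eq, Set.mem_preimage, Φ, Y]
    have : (fun q => B (τ q) ω + r * ramp t₀ T (τ q)) =
        fun q => B (τ q) ω - ramp t₀ T (τ q) * N ω + (N ω + r) * ramp t₀ T (τ q) := by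
      funext q; ring
    rw [this]
  have h0 := hrep 0
  simp only [zero_mul, add_zero] at h0
  rw [h0, hrep s]
  have := Measure.isProbabilityMeasure_map (μ := P) hYm'
  calc ∫⁻ y, gaussianReal 0 1 (Prod.mk y ⁻¹' (Φ 0 ⁻¹' A)) ∂(P.map fun ω q => Y q ω)
      ≤ ∫⁻ y, (gaussianReal 0 1 (Prod.mk y ⁻¹' (Φ s ⁻¹' A)) +
          ENNReal.ofReal (gaussianShiftDist s)) ∂(P.map fun ω q => Y q ω) := by
        refine lintegral_mono fun y => ?_
        refine (gaussianReal_le_add_shiftDist s _).trans_eq ?_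
        congr 1
        have hs := gaussianReal_map_add_const (μ := 0) (v := 1) s
        rw [zero_add] at hs
        rw [← hs, Measure.map_apply (by fun_prop)
          (measurable_prodMk_left (hΦ 0 hA))]
        congr 1
        ext x
        simp [Φ]
    _ = _ := by
        rw [lintegral_add_right _ measurable_const, lintegral_const, measure_univ, mul_one]

end

/-! ### Reconstruction of a continuous path from its values on grids -/

/-- The grid point `T k / n`, as a function of `(n, k)`. -/
def gridTime (T : ℝ≥0) (q : ℕ × ℕ) : ℝ≥0 := T * (q.2 / q.1)

/-- The Bernstein polynomial with the given grid values. -/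
def bernsteinPath (n : ℕ) (s : ℕ × ℕ → ℝ) : C(unitInterval, ℝ) :=
  ∑ k : Fin (n + 1), bernstein n k • ContinuousMap.const _ (s (n, k))

/-- The continuous path with the given grid values. -/
def pathOfGrid (s : ℕ × ℕ → ℝ) : C(unitInterval, ℝ) :=
  limUnder atTop fun n => bernsteinPath n s

/-- Each Bernstein approximant depends continuously on finitely many grid values, and limits of such
maps are measurable. Crossing events thus become measurable functions of countably many Brownian
values. -/
lemma stronglyMeasurable_pathOfGrid : StronglyMeasurable pathOfGrid := by
  refine StronglyMeasurable.limUnder fun n => Continuous.stronglyMeasurable ?_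
  unfold bernsteinPath
  refine continuous_finsetSum _ fun k _ => ?_
  have h1 : Continuous fun s : ℕ × ℕ → ℝ => s (n, (k : ℕ)) := continuous_apply _
  have h2 : Continuous fun y : ℝ => (ContinuousMap.const unitInterval y) :=
    ContinuousMap.continuous_const'
  exact (h2.comp h1).const_smul (bernstein n k)

/-- A path on `[0, 1]`, rescaled to `[0, T]` and extended by constants. -/
def rescale (T : ℝ) (p : C(unitInterval, ℝ)) (t : ℝ) : ℝ :=
  p (Set.projIcc 0 1 zero_le_one (t / T))

lemma continuous_rescale (T : ℝ) (p : C(unitInterval, ℝ)) : Continuous (rescale T p) := by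
  unfold rescale
  exact p.continuous.comp (continuous_projIcc.comp (by fun_prop))

lemma rescale_pathOfGrid {T : ℝ≥0} (hT : 0 < T) {f : ℝ → ℝ} (hf : Continuous f) {t : ℝ}
    (ht : t ∈ Set.Icc 0 (T : ℝ)) :
    rescale T (pathOfGrid fun q => f (gridTime T q)) t = f t := by
  let φ : C(unitInterval, ℝ) := ⟨fun x => f (T * x), by fun_prop⟩
  have h1 : (fun n => bernsteinPath n fun q => f (gridTime T q)) =
      fun n => bernsteinApproximation n φ := by
    funext n
    unfold bernsteinPath bernsteinApproximation
    refine Finset.sum_congr rfl fun k _ => ?_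
    congr 2
  have h2 : (pathOfGrid fun q => f (gridTime T q)) = φ := by
    unfold pathOfGrid
    rw [h1]
    exact (bernsteinApproximation_uniform φ).limUnder_eq
  have hT' : (0 : ℝ) < T := by exact_mod_cast hT
  have h3 : t / T ∈ Set.Icc (0 : ℝ) 1 :=
    ⟨div_nonneg ht.1 hT'.le, (div_le_one hT').2 ht.2⟩
  rw [h2, rescale, Set.projIcc_of_mem _ h3]
  simp only [φ, ContinuousMap.coe_mk]
  congr 1
  field_simp

/-! ### Measurability, symmetry and shift stability of crossing probabilities -/

section

variable {F : ℝ → ℝ → ℝ} {m M ε : ℝ}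

/-- The grid values for which the solution of the equation with forcing `c w + h` crosses the cone
from below. -/
def crossingGrids (F : ℝ → ℝ → ℝ) (ε a T c : ℝ) (h : ℝ → ℝ) : Set (ℕ × ℕ → ℝ) :=
  {s | CrossesBelow a T (solve F ε T fun t => c * rescale T (pathOfGrid s) t + h t)}

/-- The solution at a fixed time is a Lipschitz function of the forcing path, and by continuity only
rational times matter for the crossing. -/
lemma measurableSet_crossingGrids (hF : IsDriftField F m M) (hm : 0 ≤ m) (hM : 0 ≤ M)
    (hε : 0 < ε) {T : ℝ} (hT : 0 ≤ T) (a c : ℝ) {h : ℝ → ℝ} (hh : Continuous h) :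
    MeasurableSet (crossingGrids F ε a T c h) := by
  have hcont : ∀ p, Continuous fun t => c * rescale T p t + h t := fun p =>
    ((continuous_rescale T p).const_mul c).add hh
  have hmeas : ∀ t ∈ Set.Icc 0 T, Measurable fun s =>
      solve F ε T (fun t => c * rescale T (pathOfGrid s) t + h t) t := fun t ht => by
    have hc : Continuous fun p : C(unitInterval, ℝ) =>
        solve F ε T (fun t => c * rescale T p t + h t) t := by
      have hL : LipschitzWith (Real.toNNReal (2 * |c|)) fun p : C(unitInterval, ℝ) =>
          solve F ε T (fun t => c * rescale T p t + h t) t := by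
        refine LipschitzWith.of_dist_le_mul fun p p' => ?_
        rw [Real.coe_toNNReal _ (by positivity), Real.dist_eq, mul_assoc]
        refine solve_sub_le hF hm hM hε hT (hcont p) (hcont p') (fun t _ => ?_) ht
        have : c * rescale T p t + h t - (c * rescale T p' t + h t) =
            c * (rescale T p t - rescale T p' t) := by ring
        rw [this, abs_mul]
        exact mul_le_mul_of_nonneg_left (ContinuousMap.dist_apply_le_dist (f := p) (g := p') _)
          (abs_nonneg c)
      exact hL.continuous
    exact (hc.comp_stronglyMeasurable stronglyMeasurable_pathOfGrid).measurable
  have heq : crossingGrids F ε a T c h = ⋃ q : ℚ, ⋃ (_ : (q : ℝ) ∈ Set.Icc 0 T),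
      ({s | solve F ε T (fun t => c * rescale T (pathOfGrid s) t + h t) q < -(a * (T - q))} ∩
        ⋂ q' : ℚ, ⋂ (_ : (q' : ℝ) ∈ Set.Icc 0 (q : ℝ)),
          {s | solve F ε T (fun t => c * rescale T (pathOfGrid s) t + h t) q' ≤
            a * (T - q')}) := by
    ext s
    rw [crossingGrids, Set.mem_ofPred_eq, crossesBelow_iff_rat
      (isForcedSolution_solve hF hm hM hε hT (hcont (pathOfGrid s))).continuous]
    simp only [Set.mem_iUnion, Set.mem_inter_iff, Set.mem_iInter, Set.mem_ofPred_eq, exists_prop]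
  rw [heq]
  refine MeasurableSet.iUnion fun q => MeasurableSet.iUnion fun hq => ?_
  refine (measurableSet_lt (hmeas q hq) measurable_const).inter ?_
  exact MeasurableSet.iInter fun q' => MeasurableSet.iInter fun hq' =>
    measurableSet_le (hmeas q' ⟨hq'.1, hq'.2.trans hq.2⟩) measurable_const

lemma mem_crossingGrids (hF : IsDriftField F m M) (hm : 0 ≤ m) (hM : 0 ≤ M)
    (hε : 0 < ε) {T : ℝ≥0} (hT : 0 < T) {a c : ℝ} {h : ℝ → ℝ} (hh : Continuous h)
    {f : ℝ → ℝ} (hf : Continuous f) :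
    (fun q => f (gridTime T q)) ∈ crossingGrids F ε a T c h ↔
      CrossesBelow a T (solve F ε T fun t => c * f t + h t) := by
  have h1 := isForcedSolution_solve hF hm hM hε T.coe_nonneg (n := fun t => c * f t + h t)
    ((hf.const_mul c).add hh)
  have h2 := isForcedSolution_solve hF hm hM hε T.coe_nonneg
    (n := fun t => c * rescale T (pathOfGrid fun q => f (gridTime T q)) t + h t)
    (((continuous_rescale T (pathOfGrid fun q => f (gridTime T q))).const_mul c).add hh)
  have heq : ∀ t ∈ Set.Icc 0 (T : ℝ), solve F ε T (fun t => c * rescale T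
      (pathOfGrid fun q => f (gridTime T q)) t + h t) t = solve F ε T (fun t => c * f t + h t) t :=
    fun t ht => h2.unique hF hm hε h1 (fun s hs => by rw [rescale_pathOfGrid hT hf hs]) ht
  exact ⟨fun h => h.congr heq, fun h => h.congr fun t ht => (heq t ht).symm⟩

variable {Ω : Type*} [MeasurableSpace Ω] {P : Measure Ω} {W : ℝ≥0 → Ω → ℝ}

/-- By symmetry, the undriven solution crosses below first with probability at most `1/2`. -/
lemma measureReal_crossesBelow_le_half (hF : IsDriftField F m M) (hm : 0 ≤ m) (hM : 0 ≤ M)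
    (hε : 0 < ε) {T : ℝ≥0} (hT : 0 < T) (a c : ℝ) (hW : IsBrownianReal W P) :
    P.real {ω | CrossesBelow a T (solve F ε T fun t => c * W t.toNNReal ω)} ≤ 1 / 2 ∧
    P.real {ω | CrossesBelow a T fun t => -solve F ε T (fun t => c * W t.toNNReal ω) t} ≤
      1 / 2 := by
  have := hW.isGaussianProcess.isProbabilityMeasure
  set A := crossingGrids F ε a T c fun _ => 0 with hA_def
  have hA : MeasurableSet A := measurableSet_crossingGrids hF hm hM hε T.coe_nonneg a c continuous_const
  have hmem : ∀ {f : ℝ → ℝ}, Continuous f → ((fun q => f (gridTime T q)) ∈ A ↔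
      CrossesBelow a T (solve F ε T fun t => c * f t)) := fun hf => by
    have := mem_crossingGrids hF hm hM hε hT (a := a) (c := c) (h := fun _ => 0)
      continuous_const hf
    simpa using this
  let S : Ω → ℕ × ℕ → ℝ := fun ω q => W (gridTime T q) ω
  let S' : Ω → ℕ × ℕ → ℝ := fun ω q => (-W) (gridTime T q) ω
  have hS : AEMeasurable S P := aemeasurable_sample (gridTime T) hW.toIsPreBrownianReal
  have hS' : AEMeasurable S' P := aemeasurable_sample (gridTime T) hW.neg.toIsPreBrownianReal
  have hc : ∀ᵐ ω ∂P, Continuous fun t : ℝ => W t.toNNReal ω := by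
    filter_upwards [hW.cont] with ω hω
    fun_prop
  have e1 : {ω | CrossesBelow a T (solve F ε T fun t => c * W t.toNNReal ω)} =ᵐ[P] S ⁻¹' A := by
    filter_upwards [hc] with ω hω
    have := hmem hω
    simp only [Real.toNNReal_coe] at this
    exact propext this.symm
  have e2 : {ω | CrossesBelow a T fun t => -solve F ε T (fun t => c * W t.toNNReal ω) t}
      =ᵐ[P] S' ⁻¹' A := by
    filter_upwards [hc] with ω hω
    have h1 := hmem (f := fun t => -W t.toNNReal ω) hω.neg
    simp only [Real.toNNReal_coe] at h1
    have h2 : ∀ t ∈ Set.Icc 0 (T : ℝ), solve F ε T (fun t => c * -W t.toNNReal ω) t =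
        -solve F ε T (fun t => c * W t.toNNReal ω) t := fun t ht => by
      rw [← solve_neg hF hm hM hε T.coe_nonneg (hω.const_mul c) ht]
      simp only [mul_neg]
    exact propext ⟨fun h => h1.2 (h.congr fun t ht => (h2 t ht).symm), fun h => (h1.1 h).congr h2⟩
  have hlaw : P.real (S ⁻¹' A) = P.real (S' ⁻¹' A) := by
    rw [← map_measureReal_apply_of_aemeasurable hS hA,
      ← map_measureReal_apply_of_aemeasurable hS' hA,
      map_sample_eq (gridTime T) hW.toIsPreBrownianReal hW.neg.toIsPreBrownianReal]
  have hdisj : AEDisjoint P (S ⁻¹' A) (S' ⁻¹' A) := by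
    have h0 : Disjoint {ω | CrossesBelow a T (solve F ε T fun t => c * W t.toNNReal ω)}
        {ω | CrossesBelow a T fun t => -solve F ε T (fun t => c * W t.toNNReal ω) t} :=
      Set.disjoint_left.2 fun ω h h' => CrossesBelow.not_neg h h'
    exact h0.aedisjoint.congr e1.symm e2.symm
  have hsum : P.real (S ⁻¹' A) + P.real (S' ⁻¹' A) ≤ 1 := by
    rw [← measureReal_union₀ (hS'.nullMeasurableSet_preimage hA) hdisj]
    exact measureReal_le_one
  rw [measureReal_congr e1, measureReal_congr e2]
  constructor <;> linarith

/-- Changing the forcing by a ramp changes the crossing probability by at most the distance between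
the normal law and its translate. -/
lemma measureReal_crossesBelow_le_shift (hF : IsDriftField F m M) (hm : 0 ≤ m) (hM : 0 ≤ M)
    (hε : 0 < ε) {t₀ T : ℝ≥0} (hT : t₀ < T) (a : ℝ) {c : ℝ} (hc : c ≠ 0)
    (hW : IsBrownianReal W P) {h : ℝ → ℝ} (hh : Continuous h) (κ : ℝ) :
    P.real {ω | CrossesBelow a T (solve F ε T fun t => c * W t.toNNReal ω + h t)} ≤
      P.real {ω | CrossesBelow a T
        (solve F ε T fun t => c * W t.toNNReal ω + (κ * max (t - t₀) 0 + h t))} +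
      gaussianShiftDist (κ / c * √(T - t₀)) := by
  have := hW.isGaussianProcess.isProbabilityMeasure
  have hT0 : 0 < T := zero_le.trans_lt hT
  set s := κ / c * √((T : ℝ) - t₀) with hs
  set A := crossingGrids F ε a T c h with hA_def
  have hA : MeasurableSet A := measurableSet_crossingGrids hF hm hM hε T.coe_nonneg a c hh
  have hcW : ∀ᵐ ω ∂P, Continuous fun t : ℝ => W t.toNNReal ω := by
    filter_upwards [hW.cont] with ω hω
    fun_prop
  have hd : (0 : ℝ) < T - t₀ := sub_pos.2 (by exact_mod_cast hT)
  have hd0 : 0 < √((T : ℝ) - t₀) := Real.sqrt_pos.2 hd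
  have hramp : ∀ t : ℝ, 0 ≤ t → t ≤ T → c * (s * ramp t₀ T t.toNNReal) = κ * max (t - t₀) 0 :=
    fun t ht htT => by
      have h1 : t.toNNReal ≤ T := by rwa [Real.toNNReal_le_iff_le_coe]
      rw [ramp, min_eq_left h1, NNReal.coe_min, Real.coe_toNNReal t ht, hs]
      rcases le_total t t₀ with h2 | h2
      · rw [min_eq_left h2, max_eq_right (by linarith)]
        simp
      · rw [min_eq_right h2, max_eq_left (by linarith)]
        field_simp
  have hrampc : Continuous fun t : ℝ => ramp t₀ T t.toNNReal := by
    unfold ramp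
    fun_prop
  have e1 : P.real {ω | CrossesBelow a T (solve F ε T fun t => c * W t.toNNReal ω + h t)} =
      P.real {ω | (fun q => W (gridTime T q) ω) ∈ A} := by
    refine measureReal_congr ?_
    filter_upwards [hcW] with ω hω
    have := mem_crossingGrids hF hm hM hε hT0 (a := a) (c := c) hh hω
    simp only [Real.toNNReal_coe] at this
    exact propext this.symm
  have e2 : P.real {ω | (fun q => W (gridTime T q) ω + s * ramp t₀ T (gridTime T q)) ∈ A} =
      P.real {ω | CrossesBelow a T
        (solve F ε T fun t => c * W t.toNNReal ω + (κ * max (t - t₀) 0 + h t))} := by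
    refine measureReal_congr ?_
    filter_upwards [hcW] with ω hω
    have h1 := mem_crossingGrids hF hm hM hε hT0 (a := a) (c := c) hh
      (f := fun t => W t.toNNReal ω + s * ramp t₀ T t.toNNReal) (hω.add (hrampc.const_mul s))
    simp only [Real.toNNReal_coe] at h1
    have h2 := isForcedSolution_solve hF hm hM hε T.coe_nonneg
      (n := fun t => c * (W t.toNNReal ω + s * ramp t₀ T t.toNNReal) + h t) (((hω.add (hrampc.const_mul s)).const_mul c).add hh)
    have h3 := isForcedSolution_solve hF hm hM hε T.coe_nonneg
      (n := fun t => c * W t.toNNReal ω + (κ * max (t - t₀) 0 + h t)) ((hω.const_mul c).add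
        (((by fun_prop : Continuous fun t : ℝ => κ * max (t - t₀) 0)).add hh))
    have heq := fun t (ht : t ∈ Set.Icc 0 (T : ℝ)) => h2.unique hF hm hε h3
      (fun t ht => by rw [mul_add, hramp t ht.1 ht.2]; ring) ht
    exact propext ⟨fun h => (h1.1 h).congr heq,
      fun h => h1.2 (h.congr fun t ht => (heq t ht).symm)⟩
  rw [e1, ← e2]
  have key := measure_sample_le_shift (gridTime T) hW.toIsPreBrownianReal hT s hA
  have hfin := measure_ne_top P
    {ω | (fun q => W (gridTime T q) ω + s * ramp t₀ T (gridTime T q)) ∈ A}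
  have := ENNReal.toReal_mono (ENNReal.add_ne_top.2 ⟨hfin, ENNReal.ofReal_ne_top⟩) key
  rwa [ENNReal.toReal_add hfin ENNReal.ofReal_ne_top,
    ENNReal.toReal_ofReal (gaussianShiftDist_nonneg s)] at this

end

/-! ### Bounds on the probability that the chain breaks on the left -/

section

variable {U : ℝ → ℝ} {a b a₀ u₀ κ M ε σ y : ℝ} {g : ℝ → ℝ} {T : ℝ≥0}
  {Ω : Type*} [MeasurableSpace Ω] {P : Measure Ω} {W X : ℝ≥0 → Ω → ℝ}

lemma OscBound.const_mul {w : ℝ → ℝ} {ε T r c : ℝ} (h : OscBound w ε T r) (hc : 0 ≤ c) :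
    OscBound (fun t => c * w t) ε T (c * r) := fun u t hu hut ht => by
  rw [← mul_sub, abs_mul, abs_of_nonneg hc, mul_assoc]
  exact mul_le_mul_of_nonneg_left (h u t hu hut ht) hc

/-- Almost surely, if the noise is regular then the path follows the solution of the regularized
equation until the chain breaks. -/
lemma ae_breakTime_of_oscBound (hU : IsChainPotential U a b a₀ u₀) (hM : 0 < M)
    (hg : ∀ x y, x ≤ y → u₀ * (y - x) ≤ g y - g x ∧ g y - g x ≤ M * (y - x))
    (hgU : ∀ y ∈ Set.Ioo (a - κ) b, deriv U y = g y) (hT : (T : ℝ) = b / a - 1) (hε : 0 < ε)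
    (hσ : 0 < σ) (hy : 0 ≤ y) (hX : SolvesChainSDE P U a b ε σ W X)
    (hκ : σ / √ε * (3 * y) + (σ / √ε * (3 * y) + a * ε) / (2 * u₀) < κ) :
    ∀ᵐ ω ∂P, Continuous (fun t : ℝ => σ / √ε * W t.toNNReal ω) ∧ W 0 ω = 0 ∧
      (OscBound (fun t => W t.toNNReal ω) ε T (3 * y) → ∃ τ : ℝ, 0 < τ ∧ τ ≤ T ∧
        (∀ s ∈ Set.Icc 0 τ, |solve (midDrift g a) ε T
          (fun t => σ / √ε * W t.toNNReal ω - a * t) s| ≤ a * (T - s)) ∧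
        (ω ∈ breaksLeft a b X → solve (midDrift g a) ε T
          (fun t => σ / √ε * W t.toNNReal ω - a * t) τ = a * (T - τ)) ∧
        (ω ∉ breaksLeft a b X → solve (midDrift g a) ε T
          (fun t => σ / √ε * W t.toNNReal ω - a * t) τ = -(a * (T - τ)))) := by
  have hu₀ := hU.u₀_pos
  have ha := hU.a_pos
  have hF := isDriftField_midDrift hu₀.le a hg
  have hc : 0 < σ / √ε := div_pos hσ (Real.sqrt_pos.2 hε)
  filter_upwards [hX.brownian.cont, hX.brownian.eval_zero_ae_eq_zero, hX.continuous, hX.init,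
    hX.eqn] with ω hWc hW0 hXc hX0 heqn
  have hw : Continuous fun t : ℝ => σ / √ε * W t.toNNReal ω := by fun_prop
  refine ⟨hw, hW0, fun hosc => ?_⟩
  have hZ := isForcedSolution_solve hF (by linarith) (by linarith) hε T.coe_nonneg
    (n := fun t => σ / √ε * W t.toNNReal ω - a * t) (hw.sub (by fun_prop))
  set Z := solve (midDrift g a) ε T fun t => σ / √ε * W t.toNNReal ω - a * t with hZdef
  have hZκ : ∀ t ∈ Set.Icc 0 (T : ℝ), |Z t| < κ := fun t ht => by
    refine (abs_solution_le hF (by linarith) hε (by positivity) (hosc.const_mul hc.le)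
      (by simp [hW0]) (h := fun t => -(a * t)) (by simp) ha.le (fun u t hu hut ht => ?_)
      (by simpa only [sub_eq_add_neg] using hZ) ht).trans_lt hκ
    have : -(a * t) - -(a * u) = -(a * (t - u)) := by ring
    rw [this, abs_neg, abs_of_nonneg (mul_nonneg ha.le (sub_nonneg.2 hut))]
  rw [hT] at hZ hZκ
  obtain ⟨h1, h2, h3, h4⟩ := breakTime_of_solution hU hg hgU hε hXc hX0
    (w := fun t => σ / √ε * W t.toNNReal ω) (fun t ht => by
      simp only [Real.toNNReal_coe]
      exact heqn t ht) hZ hZκ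
  refine ⟨breakTime a b fun t => X t ω, h1, ?_, ?_, ?_, ?_⟩
  · rw [hT]; exact breakTime_le ha hU.a_lt_b _
  · rw [hT]
    have hclosed : IsClosed {s | |Z s| ≤ a * (b / a - 1 - s)} :=
      isClosed_le hZ.continuous.abs (by fun_prop)
    have h5 := hclosed.closure_subset_iff.2 fun s hs => (h2 s hs).le
    rwa [closure_Ico h1.ne] at h5
  · rw [hT]; exact fun h => h3.1 h
  · rw [hT]; exact fun h => h4 h

/-- The probability that the noise is irregular. -/
def irregularBound (ε T y : ℝ) : ℝ := (T / ε + 1) * (4 * Real.exp (-y ^ 2 / (2 * ε)))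

lemma measureReal_le_of_ae_imp [IsFiniteMeasure P] {s t : Set Ω} (h : ∀ᵐ ω ∂P, ω ∈ s → ω ∈ t) :
    P.real s ≤ P.real t :=
  ENNReal.toReal_mono (measure_ne_top _ _) (measure_mono_ae h)

/-- Breaking on the left forces the undriven path across the upper side first, unless the noise is
irregular; symmetry then gives `1/2`. -/
lemma measureReal_breaksLeft_le (hU : IsChainPotential U a b a₀ u₀) (hM : 0 < M)
    (hg : ∀ x y, x ≤ y → u₀ * (y - x) ≤ g y - g x ∧ g y - g x ≤ M * (y - x))
    (hgU : ∀ y ∈ Set.Ioo (a - κ) b, deriv U y = g y) (hT : (T : ℝ) = b / a - 1) (hε : 0 < ε)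
    (hσ : 0 < σ) (hy : 0 ≤ y) (hX : SolvesChainSDE P U a b ε σ W X)
    (hκ : σ / √ε * (3 * y) + (σ / √ε * (3 * y) + a * ε) / (2 * u₀) < κ) :
    P.real (breaksLeft a b X) ≤ 1 / 2 + irregularBound ε T y := by
  have := hX.brownian.isGaussianProcess.isProbabilityMeasure
  have hu₀ := hU.u₀_pos
  have ha := hU.a_pos
  have hF := isDriftField_midDrift hu₀.le a hg
  have hT0 : 0 < T := by
    rw [← NNReal.coe_pos, hT, sub_pos, lt_div_iff₀ ha]
    linarith [hU.a_lt_b]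
  have h1 := measureReal_not_oscBound_le hX.brownian hε T.coe_nonneg hy
  have h2 := (measureReal_crossesBelow_le_half hF (by linarith) (by linarith) hε hT0 a (σ / √ε)
    hX.brownian).2
  refine (measureReal_le_of_ae_imp ?_).trans ((measureReal_union_le _ _).trans (add_le_add h2 h1))
  filter_upwards [ae_breakTime_of_oscBound hU hM hg hgU hT hε hσ hy hX hκ] with ω hω hb
  obtain ⟨hw, hW0, hosc⟩ := hω
  by_cases ho : OscBound (fun t => W t.toNNReal ω) ε T (3 * y)
  · left
    obtain ⟨τ, hτ0, hτT, hcone, hup, -⟩ := hosc ho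
    exact crossesBelow_neg_of_hits_above hF (by linarith) (by linarith) hε ha
      (isForcedSolution_solve hF (by linarith) (by linarith) hε T.coe_nonneg
        (hw.sub (by fun_prop)))
      (isForcedSolution_solve hF (by linarith) (by linarith) hε T.coe_nonneg hw)
      hτ0 hτT (hup hb) fun s hs => (abs_le.1 (hcone s hs)).1
  · exact Or.inr ho

/-- Bounds the complement: it leads to a lower crossing under forcing slope `-2a`, then, at the cost
of the shift distance, under the reversed slope after `t₀`, then for the undriven path. Irregular
noise is discarded twice. -/
lemma le_measureReal_breaksLeft (hU : IsChainPotential U a b a₀ u₀) (hM : 0 < M)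
    (hg : ∀ x y, x ≤ y → u₀ * (y - x) ≤ g y - g x ∧ g y - g x ≤ M * (y - x))
    (hgU : ∀ y ∈ Set.Ioo (a - κ) b, deriv U y = g y) (hT : (T : ℝ) = b / a - 1) (hε : 0 < ε)
    (hσ : 0 < σ) (hy : 0 ≤ y) (hX : SolvesChainSDE P U a b ε σ W X)
    (hκ : σ / √ε * (3 * y) + (σ / √ε * (3 * y) + a * ε) / (2 * u₀) < κ) {t₀ : ℝ≥0} (ht₀ : t₀ < T)
    (hsep : σ / √ε * (3 * y) + (σ / √ε * (3 * y) + 2 * a * ε) / (2 * u₀) +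
      a * (ε * (2 / (2 * u₀) + 1 / (2 * M))) < a * (T - t₀)) :
    1 / 2 - 2 * irregularBound ε T y - gaussianShiftDist (4 * a / (σ / √ε) * √(T - t₀)) ≤
      P.real (breaksLeft a b X) := by
  have := hX.brownian.isGaussianProcess.isProbabilityMeasure
  have hu₀ := hU.u₀_pos
  have ha := hU.a_pos
  have hF := isDriftField_midDrift hu₀.le a hg
  have hc : 0 < σ / √ε := div_pos hσ (Real.sqrt_pos.2 hε)
  have hT0 : 0 < T := zero_le.trans_lt ht₀
  have h1 : P.real {ω | ¬ OscBound (fun t => W t.toNNReal ω) ε T (3 * y)} ≤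
    irregularBound ε T y := measureReal_not_oscBound_le hX.brownian hε T.coe_nonneg hy
  have h2 := (measureReal_crossesBelow_le_half hF (by linarith) (by linarith) hε hT0 a (σ / √ε)
    hX.brownian).1
  have h3 := measureReal_crossesBelow_le_shift hF (by linarith) (by linarith) hε ht₀ a hc.ne'
    hX.brownian (h := fun t => -(2 * a * t)) (by fun_prop) (4 * a)
  have hae := ae_breakTime_of_oscBound hU hM hg hgU hT hε hσ hy hX hκ
  have h4 : P.real (breaksLeft a b X)ᶜ ≤
      P.real {ω | CrossesBelow a T (solve (midDrift g a) ε T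
        fun t => σ / √ε * W t.toNNReal ω + -(2 * a * t))} + irregularBound ε T y := by
    refine (measureReal_le_of_ae_imp ?_).trans ((measureReal_union_le _ _).trans
      (add_le_add le_rfl h1))
    filter_upwards [hae] with ω hω hb
    obtain ⟨hw, hW0, hosc⟩ := hω
    by_cases ho : OscBound (fun t => W t.toNNReal ω) ε T (3 * y)
    · left
      obtain ⟨τ, hτ0, hτT, hcone, -, hdown⟩ := hosc ho
      refine crossesBelow_of_hits_below (w := fun t => σ / √ε * W t.toNNReal ω) hF (by linarith)
        (by linarith) hε ha
        (isForcedSolution_solve hF (by linarith) (by linarith) hε T.coe_nonneg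
          (hw.sub (by fun_prop)))
        ?_ hτ0 hτT (hdown hb) fun s hs => (abs_le.1 (hcone s hs)).2
      simp only [sub_eq_add_neg]
      exact isForcedSolution_solve hF (by linarith) (by linarith) hε T.coe_nonneg
        (hw.add (by fun_prop))
    · exact Or.inr ho
  have h5 : P.real {ω | CrossesBelow a T (solve (midDrift g a) ε T
      fun t => σ / √ε * W t.toNNReal ω + (4 * a * max (t - t₀) 0 + -(2 * a * t)))} ≤
      1 / 2 + irregularBound ε T y := by
    refine (measureReal_le_of_ae_imp ?_).trans ((measureReal_union_le _ _).trans
      (add_le_add h2 h1))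
    filter_upwards [hae] with ω hω hb
    obtain ⟨hw, hW0, hosc⟩ := hω
    by_cases ho : OscBound (fun t => W t.toNNReal ω) ε T (3 * y)
    · left
      refine crossesBelow_of_reversed hF (by linarith) (by linarith) hε ha (by positivity)
        (ho.const_mul hc.le) (by simp [hW0]) t₀.coe_nonneg hsep ?_
        (isForcedSolution_solve hF (by linarith) (by linarith) hε T.coe_nonneg hw) hb
      simp only [sub_eq_add_neg]
      exact isForcedSolution_solve hF (by linarith) (by linarith) hε T.coe_nonneg
        (hw.add (by fun_prop))
    · exact Or.inr ho
  have h6 : (1 : ℝ) ≤ P.real (breaksLeft a b X) + P.real (breaksLeft a b X)ᶜ := by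
    rw [← probReal_univ (μ := P), ← Set.union_compl_self (breaksLeft a b X)]
    exact measureReal_union_le _ _
  linarith

lemma measureReal_breaksLeft_le_irregularBound (hU : IsChainPotential U a b a₀ u₀) (hM : 0 < M)
    (hg : ∀ x y, x ≤ y → u₀ * (y - x) ≤ g y - g x ∧ g y - g x ≤ M * (y - x))
    (hgU : ∀ y ∈ Set.Ioo (a - κ) b, deriv U y = g y) (hT : (T : ℝ) = b / a - 1) (hε : 0 < ε)
    (hσ : 0 < σ) (hy : 0 ≤ y) (hX : SolvesChainSDE P U a b ε σ W X)
    (hκ : σ / √ε * (3 * y) + (σ / √ε * (3 * y) + a * ε) / (2 * u₀) < κ)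
    (hr₁ : σ / √ε * (3 * y) ≤ a * ε / 2) (hr₂ : σ / √ε * (3 * y) < a * ε / (4 * (2 * M)))
    (hsep : σ / √ε * (3 * y) + σ / √ε * (3 * y) / (2 * u₀) < a * (T - ε / (2 * M))) :
    P.real (breaksLeft a b X) ≤ irregularBound ε T y := by
  have := hX.brownian.isGaussianProcess.isProbabilityMeasure
  have hu₀ := hU.u₀_pos
  have ha := hU.a_pos
  have hF := isDriftField_midDrift hu₀.le a hg
  have hc : 0 < σ / √ε := div_pos hσ (Real.sqrt_pos.2 hε)
  refine (measureReal_le_of_ae_imp ?_).trans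
    (measureReal_not_oscBound_le hX.brownian hε T.coe_nonneg hy)
  filter_upwards [ae_breakTime_of_oscBound hU hM hg hgU hT hε hσ hy hX hκ] with ω hω hb ho
  obtain ⟨hw, hW0, hosc⟩ := hω
  obtain ⟨τ, hτ0, hτT, -, hup, -⟩ := hosc ho
  have h1 := lt_of_small_noise hF (by linarith) (by linarith) hε ha (by positivity)
    (ho.const_mul hc.le) (by simp [hW0]) hr₁ hr₂ hsep
    (isForcedSolution_solve hF (by linarith) (by linarith) hε T.coe_nonneg
      (hw.sub (by fun_prop))) ⟨hτ0.le, hτT⟩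
  exact absurd (hup hb) h1.ne

end

/-! ### Reduction of the deviation process to the middle particle -/

section

variable {U V : ℝ → ℝ} {a b a₀ u₀ ε σ : ℝ} {xdet : ℝ → ℝ}

/-- The position of the middle particle, with the deterministic motion stopped at `b/a - 1`. -/
def position {Ω : Type*} (a b : ℝ) (xdet : ℝ → ℝ) (Y : ℝ≥0 → Ω → ℝ) (t : ℝ≥0) (ω : Ω) : ℝ :=
  xdet (min (t : ℝ) (b / a - 1)) + Y t ω

lemma position_of_le {Ω : Type*} (Y : ℝ≥0 → Ω → ℝ) {t : ℝ≥0} (ht : (t : ℝ) ≤ b / a - 1) (ω : Ω) :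
    position a b xdet Y t ω = xdet t + Y t ω := by
  rw [position, min_eq_left ht]

lemma breakTime_position {Ω : Type*} (ha : 0 < a) (Y : ℝ≥0 → Ω → ℝ) (ω : Ω) :
    breakTime a b (fun s => position a b xdet Y s ω) =
      deviationExitTime a b xdet fun s => Y s ω := by
  unfold breakTime deviationExitTime
  congr 1
  ext t
  simp only [Set.mem_ofPred_eq, deviationDomain, dMinus, dPlus, Set.mem_Ioo]
  rcases le_or_gt (t : ℝ) (b / a - 1) with ht | ht
  · rw [position_of_le Y ht]
    refine not_congr ⟨fun h => ⟨by linarith [h.1], by linarith [h.2], t.2, ht⟩,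
      fun h => ⟨by linarith [h.1], by linarith [h.2.1]⟩⟩
  -- After `b/a - 1` the interval `(2a(1+t) - b, b)` is empty, so freezing the deterministic motion
  -- there does not affect the exit time.
  · refine iff_of_true (fun h => ?_) fun h => absurd h.2.2.2 (not_le.2 ht)
    have : 2 * a * (1 + (b / a - 1)) - b = b := by field_simp; ring
    have h1 := h.1.trans h.2
    nlinarith

lemma breaksLeft_position {Ω : Type*} (ha : 0 < a) (hab : a < b) (Y : ℝ≥0 → Ω → ℝ) :
    breaksLeft a b (position a b xdet Y) = deviationExitsAbove a b xdet Y := by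
  ext ω
  have h := breakTime_le ha hab fun s => position a b xdet Y s ω
  simp only [breaksLeft, deviationExitsAbove, Set.mem_ofPred_eq]
  rw [breakTime_position ha] at h ⊢
  rw [position_of_le Y h, dPlus]
  constructor <;> intro h' <;> linarith

lemma IsConvexExtension.differentiableAt (hV : IsConvexExtension V U b a₀) {y : ℝ} (hy : 0 < y) :
    DifferentiableAt ℝ V y :=
  (hV.contDiffOn.contDiffAt (Ioi_mem_nhds hy)).differentiableAt (by norm_num)

lemma IsConvexExtension.continuousOn_deriv (hV : IsConvexExtension V U b a₀) :
    ContinuousOn (deriv V) (Set.Ioi 0) :=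
  hV.contDiffOn.continuousOn_deriv_of_isOpen isOpen_Ioi (by norm_num)

lemma IsConvexExtension.deriv_eq (hV : IsConvexExtension V U b a₀) {y : ℝ}
    (hy : y ∈ Set.Ioo 0 b) : deriv V y = deriv U y := by
  refine Filter.EventuallyEq.deriv_eq ?_
  filter_upwards [Ioo_mem_nhds hy.1 hy.2] with v hv
  exact hV.eq_of_le v (by rw [abs_of_pos hv.1]; exact hv.2.le)

/-- The derivative `V'(x) - V'(2a(1+s) - x)` of the energy is continuous along continuous paths. -/
lemma IsConvexExtension.continuousOn_force (hV : IsConvexExtension V U b a₀) {x : ℝ → ℝ}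
    {S : Set ℝ} (hx : ContinuousOn x S) (h : ∀ s ∈ S, 0 < x s ∧ x s < 2 * a * (1 + s)) :
    ContinuousOn (fun s => deriv V (x s) - deriv V (2 * a * (1 + s) - x s)) S :=
  (hV.continuousOn_deriv.comp hx fun s hs => (h s hs).1).sub
    (hV.continuousOn_deriv.comp (ContinuousOn.sub (by fun_prop) hx) fun s hs => by
      simp only [Set.mem_Ioi]
      linarith [(h s hs).2])

lemma SolvesDeterministic.continuousOn (hx : SolvesDeterministic V a b ε xdet) :
    ContinuousOn xdet (Set.Icc 0 (b / a - 1)) :=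
  fun t ht => (hx.eqn t ht).continuousWithinAt

lemma SolvesDeterministic.eq_integral (hV : IsConvexExtension V U b a₀)
    (hx : SolvesDeterministic V a b ε xdet) {t : ℝ} (ht : t ∈ Set.Icc 0 (b / a - 1)) :
    xdet t = a + ∫ s in (0 : ℝ)..t,
      -(1 / ε) * (deriv V (xdet s) - deriv V (2 * a * (1 + s) - xdet s)) := by
  have hsub : Set.Icc 0 t ⊆ Set.Icc 0 (b / a - 1) := Set.Icc_subset_Icc_right ht.2
  have hc := hV.continuousOn_force (a := a) (hx.continuousOn.mono hsub)
    fun s hs => ⟨hx.pos s (hsub hs), hx.lt s (hsub hs)⟩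
  have h := intervalIntegral.integral_eq_sub_of_hasDeriv_right_of_le ht.1
    (hx.continuousOn.mono hsub) (f' := fun s =>
      -(1 / ε) * (deriv V (xdet s) - deriv V (2 * a * (1 + s) - xdet s))) (fun s hs => ?_)
    ((hc.const_mul (-(1 / ε))).intervalIntegrable_of_Icc ht.1)
  · rw [h, hx.init]; ring
  · have hs' := hsub (Set.Ioo_subset_Icc_self hs)
    have h1 := hx.eqn s hs'
    rw [energyDeriv_eq (hV.differentiableAt (hx.pos s hs'))
      (hV.differentiableAt (by linarith [hx.lt s hs']))] at h1
    exact h1.mono_of_mem_nhdsWithin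
      (mem_nhdsWithin_of_mem_nhds (Icc_mem_nhds hs.1 (hs.2.trans_le ht.2)))

/-- Adding the integral equation of the deterministic motion to that of the deviation cancels the
reference terms, and before breaking both bonds lie in `(0, b)`, where the derivatives of `V` and
`U` agree. -/
lemma SolvesDeviationSDE.solvesChainSDE (hU : IsChainPotential U a b a₀ u₀)
    (hV : IsConvexExtension V U b a₀) (hx : SolvesDeterministic V a b ε xdet)
    {Ω : Type*} [MeasurableSpace Ω] {P : Measure Ω} {W Y : ℝ≥0 → Ω → ℝ}
    (hY : SolvesDeviationSDE P V a b ε σ xdet W Y) :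
    SolvesChainSDE P U a b ε σ W (position a b xdet Y) := by
  have ha := hU.a_pos
  have hab := hU.a_lt_b
  have hb2 := hU.b_lt
  have hT : 0 ≤ b / a - 1 := by
    rw [sub_nonneg, le_div_iff₀ ha]; linarith
  have hxc : Continuous fun t : ℝ≥0 => xdet (min (t : ℝ) (b / a - 1)) :=
    hx.continuousOn.comp_continuous (by fun_prop) fun t => ⟨le_min t.coe_nonneg hT, min_le_right _ _⟩
  have hcont : ∀ᵐ ω ∂P, Continuous fun t => position a b xdet Y t ω := by
    filter_upwards [hY.continuous] with ω hω using hxc.add hω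
  refine ⟨hY.brownian, hcont, ?_, ?_⟩
  · filter_upwards [hY.init] with ω hω
    rw [position_of_le Y (by simpa using hT), hω]
    simp [hx.init]
  filter_upwards [hcont, hY.eqn] with ω hXc heqn t ht
  have htT : (t : ℝ) ≤ b / a - 1 :=
    (NNReal.coe_le_coe.2 ht).trans (breakTime_le ha hab _)
  have hYt := heqn t (by rwa [breakTime_position ha] at ht)
  have hdet_eq := hx.eq_integral hV (t := (t : ℝ)) ⟨t.coe_nonneg, htT⟩
  set τ := breakTime a b fun s => position a b xdet Y s ω with hτ
  have hsub : Set.Icc 0 (t : ℝ) ⊆ Set.Icc 0 (b / a - 1) := Set.Icc_subset_Icc_right htT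
  let x : ℝ → ℝ := fun s => position a b xdet Y s.toNNReal ω
  have hxcont : Continuous x := hXc.comp continuous_real_toNNReal
  have hxeq : ∀ s ∈ Set.Icc 0 (t : ℝ), x s = xdet s + Y s.toNNReal ω := fun s hs => by
    simp only [x]
    rw [position_of_le Y (by rw [Real.coe_toNNReal s hs.1]; exact (hsub hs).2),
      Real.coe_toNNReal s hs.1]
  have hxIoo : ∀ s ∈ Set.Ico 0 (t : ℝ), x s ∈ Set.Ioo (2 * a * (1 + s) - b) b := fun s hs => by
    have h1 : s.toNNReal < τ := lt_of_lt_of_le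
      (by rw [← NNReal.coe_lt_coe, Real.coe_toNNReal s hs.1]; exact hs.2) ht
    have h2 := mem_of_lt_breakTime h1
    rwa [Real.coe_toNNReal s hs.1] at h2
  rcases t.coe_nonneg.eq_or_lt with h0 | h0
  · rw [position_of_le Y htT, hYt, ← h0, intervalIntegral.integral_same,
      intervalIntegral.integral_same, hx.init]
    ring
  have hxIcc : ∀ s ∈ Set.Icc 0 (t : ℝ), 2 * a * (1 + s) - b ≤ x s ∧ x s ≤ b := by
    have hclosed : IsClosed {s | 2 * a * (1 + s) - b ≤ x s ∧ x s ≤ b} :=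
      (isClosed_le (by fun_prop) hxcont).inter (isClosed_le hxcont continuous_const)
    have h5 := hclosed.closure_subset_iff.2 fun s hs => ⟨(hxIoo s hs).1.le, (hxIoo s hs).2.le⟩
    rwa [closure_Ico (ne_of_lt h0)] at h5
  -- Integrability is needed up to the closed endpoint, where a bond may have length `b`; `V`,
  -- unlike `U`, is smooth there.
  have hforce := hV.continuousOn_force (a := a) (x := x) hxcont.continuousOn (S := Set.Icc 0 (t : ℝ))
    fun s hs => by
      have h1 := hxIcc s hs
      have h2 : 0 ≤ a * s := mul_nonneg ha.le hs.1
      constructor <;> nlinarith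
  have hdet := hV.continuousOn_force (a := a) (hx.continuousOn.mono hsub)
    fun s hs => ⟨hx.pos s (hsub hs), hx.lt s (hsub hs)⟩
  have e₁ : ∫ s in (0 : ℝ)..t, 1 / ε * deviationDrift V a xdet (Y s.toNNReal ω) s =
      ∫ s in (0 : ℝ)..t, (-(1 / ε) * (deriv V (x s) - deriv V (2 * a * (1 + s) - x s)) -
        -(1 / ε) * (deriv V (xdet s) - deriv V (2 * a * (1 + s) - xdet s))) := by
    refine intervalIntegral.integral_congr fun s hs => ?_
    rw [Set.uIcc_of_le t.coe_nonneg] at hs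
    simp only [deviationDrift]
    rw [hxeq s hs]
    ring
  have e₂ : ∫ s in (0 : ℝ)..t, -(1 / ε) * energyDeriv U a (position a b xdet Y s.toNNReal ω) s =
      ∫ s in (0 : ℝ)..t, -(1 / ε) * (deriv V (x s) - deriv V (2 * a * (1 + s) - x s)) := by
    rw [intervalIntegral.integral_of_le t.coe_nonneg, intervalIntegral.integral_of_le t.coe_nonneg,
      integral_Ioc_eq_integral_Ioo, integral_Ioc_eq_integral_Ioo]
    refine setIntegral_congr_fun measurableSet_Ioo fun s hs => ?_
    have h1 := hxIoo s ⟨hs.1.le, hs.2⟩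
    have h2 : 0 ≤ a * s := mul_nonneg ha.le hs.1.le
    have h3 : x s ∈ Set.Ioo 0 b := ⟨by nlinarith [h1.1], h1.2⟩
    have h4 : 2 * a * (1 + s) - x s ∈ Set.Ioo 0 b :=
      ⟨by nlinarith [h1.2], by linarith [h1.1]⟩
    have h5 := energyDeriv_eq (hU.differentiableAt h3) (hU.differentiableAt h4)
    rw [hV.deriv_eq h3, hV.deriv_eq h4, ← h5]
  rw [intervalIntegral.integral_sub
    ((hforce.const_mul (-(1 / ε))).intervalIntegrable_of_Icc t.coe_nonneg)
    ((hdet.const_mul (-(1 / ε))).intervalIntegrable_of_Icc t.coe_nonneg)] at e₁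
  rw [position_of_le Y htT, e₂]
  linarith

end

/-! ### Asymptotics -/

section

variable {ε : ℝ → ℝ}

lemma FastStretching.tendsto_zero (h : FastStretching ε) : Tendsto ε (𝓝[>] 0) (𝓝 0) := by
  have := h.2
  simpa [MuchLess] using this

lemma eventually_one_le_abs_log : ∀ᶠ σ in 𝓝[>] (0 : ℝ), 0 < σ ∧ σ < 1 ∧ 1 ≤ |Real.log σ| := by
  have h1 : Set.Ioo (0 : ℝ) (Real.exp (-1)) ∈ 𝓝[>] (0 : ℝ) :=
    Ioo_mem_nhdsGT (Real.exp_pos _)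
  filter_upwards [h1] with σ hσ
  have h2 := (Real.log_lt_log hσ.1 hσ.2)
  rw [Real.log_exp] at h2
  refine ⟨hσ.1, hσ.2.trans (by rw [Real.exp_lt_one_iff]; norm_num), ?_⟩
  rw [abs_of_neg (by linarith)]
  linarith

lemma SlowStretching.tendsto_zero (h : SlowStretching ε) (hε : ∀ᶠ σ in 𝓝[>] (0 : ℝ), 0 < ε σ) :
    Tendsto ε (𝓝[>] 0) (𝓝 0) := by
  have hσ : Tendsto (fun σ : ℝ => σ) (𝓝[>] 0) (𝓝 0) := nhdsWithin_le_nhds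
  refine squeeze_zero' (hε.mono fun _ h => h.le) ?_ hσ
  filter_upwards [eventually_one_le_abs_log, h.2.eventually (ge_mem_nhds one_pos)] with σ h1 h2
  have h3 : 0 < |Real.log σ| ^ (-(1 / 2) : ℝ) := Real.rpow_pos_of_pos (by linarith) _
  rw [div_le_one (mul_pos h1.1 h3)] at h2
  have h4 : |Real.log σ| ^ (-(1 / 2) : ℝ) ≤ 1 :=
    Real.rpow_le_one_of_one_le_of_nonpos h1.2.2 (by norm_num)
  nlinarith [h1.1]

/-- Eventually `σ ≤ ε`, so `|ln ε|` may be replaced by `|ln σ|`. -/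
lemma FastStretching.tendsto_noise (h : FastStretching ε)
    (hε : ∀ᶠ σ in 𝓝[>] (0 : ℝ), 0 < ε σ) :
    Tendsto (fun σ => σ * √(-Real.log (ε σ)) / ε σ) (𝓝[>] 0) (𝓝 0) := by
  refine squeeze_zero' ?_ ?_ h.1
  · filter_upwards [hε, eventually_one_le_abs_log] with σ h1 h2
    exact div_nonneg (mul_nonneg h2.1.le (Real.sqrt_nonneg _)) h1.le
  · filter_upwards [hε, eventually_one_le_abs_log, h.1.eventually (ge_mem_nhds one_pos)]
      with σ h1 h2 h3
    rw [div_le_one h1] at h3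
    rw [← Real.sqrt_eq_rpow] at h3 ⊢
    have h4 : 1 ≤ √|Real.log σ| := Real.one_le_sqrt.2 h2.2.2
    have h5 : σ ≤ ε σ := by nlinarith [h2.1]
    have h6 := Real.log_le_log h2.1 h5
    have h7 : -Real.log (ε σ) ≤ |Real.log σ| := by
      have := neg_le_abs (Real.log σ)
      linarith
    gcongr
    exact h2.1.le

/-- The exponential lower bound on `ε` enters here: it yields `|ln ε| ≤ σ^{-2/3}`, hence `σ² |ln ε|
≤ σ^{4/3}`. -/
lemma SlowStretching.tendsto_noise (h : SlowStretching ε)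
    (hε : ∀ᶠ σ in 𝓝[>] (0 : ℝ), 0 < ε σ) :
    Tendsto (fun σ => σ * √(-Real.log (ε σ))) (𝓝[>] 0) (𝓝 0) := by
  have hσ : Tendsto (fun σ : ℝ => σ) (𝓝[>] 0) (𝓝 0) := nhdsWithin_le_nhds
  have hlim : Tendsto (fun σ : ℝ => √(σ ^ (4 / 3 : ℝ))) (𝓝[>] 0) (𝓝 0) := by
    have h1 := (hσ.rpow_const (p := (4 / 3 : ℝ)) (Or.inr (by norm_num))).sqrt
    rwa [Real.zero_rpow (by norm_num), Real.sqrt_zero] at h1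
  refine squeeze_zero' ?_ ?_ hlim
  · filter_upwards [eventually_one_le_abs_log] with σ h2
    exact mul_nonneg h2.1.le (Real.sqrt_nonneg _)
  · filter_upwards [hε, eventually_one_le_abs_log, h.1.eventually (ge_mem_nhds one_pos)]
      with σ h1 h2 h3
    rw [div_le_one h1] at h3
    have hq0 : 0 < σ ^ (2 / 3 : ℝ) := Real.rpow_pos_of_pos h2.1 _
    have hq1 : σ ^ (2 / 3 : ℝ) ≤ 1 := Real.rpow_le_one h2.1.le h2.2.1.le (by norm_num)
    have h4 : Real.exp (-(1 / σ ^ (2 / 3 : ℝ))) ≤ ε σ := by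
      refine le_trans ?_ h3
      refine le_mul_of_one_le_left (Real.exp_pos _).le ?_
      rwa [le_div_iff₀ hq0, one_mul]
    have h5 := Real.log_le_log (Real.exp_pos _) h4
    rw [Real.log_exp] at h5
    have h6 : σ * √(-Real.log (ε σ)) = √(σ ^ 2 * -Real.log (ε σ)) := by
      rw [Real.sqrt_mul (sq_nonneg σ), Real.sqrt_sq h2.1.le]
    have h7 : σ ^ (4 / 3 : ℝ) = σ ^ 2 * (1 / σ ^ (2 / 3 : ℝ)) := by
      rw [mul_one_div, ← Real.rpow_natCast, ← Real.rpow_sub h2.1]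
      norm_num
    rw [h6, h7]
    refine Real.sqrt_le_sqrt ?_
    exact mul_le_mul_of_nonneg_left (by linarith) (sq_nonneg σ)

lemma SlowStretching.tendsto_ratio (h : SlowStretching ε)
    (hε : ∀ᶠ σ in 𝓝[>] (0 : ℝ), 0 < ε σ) :
    Tendsto (fun σ => ε σ * √(-Real.log (ε σ)) / σ) (𝓝[>] 0) (𝓝 0) := by
  have hε0 := h.tendsto_zero hε
  have hlim : Tendsto (fun σ => √2 * (ε σ / (σ * |Real.log σ| ^ (-(1 / 2) : ℝ))) +
      √(-(ε σ * Real.log (ε σ)))) (𝓝[>] 0) (𝓝 0) := by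
    have h1 := (Real.continuous_mul_log.tendsto 0).comp hε0
    have h2 := h1.neg.sqrt
    have h3 := (h.2.const_mul (√2)).add h2
    simpa using h3
  refine squeeze_zero' ?_ ?_ hlim
  · filter_upwards [hε, eventually_one_le_abs_log] with σ h1 h2
    exact div_nonneg (mul_nonneg h1.le (Real.sqrt_nonneg _)) h2.1.le
  · filter_upwards [hε, eventually_one_le_abs_log, hε0.eventually (ge_mem_nhds one_pos)]
      with σ h1 h2 h3
    have hL : 0 ≤ -Real.log (ε σ) := neg_nonneg.2 (Real.log_nonpos h1.le h3)
    have h0 : 0 < |Real.log σ| := by linarith [h2.2.2]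
    have h4 : ε σ / (σ * |Real.log σ| ^ (-(1 / 2) : ℝ)) = ε σ * √|Real.log σ| / σ := by
      rw [Real.rpow_neg h0.le, ← Real.sqrt_eq_rpow]
      have : √|Real.log σ| ≠ 0 := (Real.sqrt_pos.2 h0).ne'
      have := h2.1.ne'
      field_simp
    rw [h4]
    -- If `ε ≥ σ²`, then `|ln ε| ≤ 2 |ln σ|` and the upper bound on `ε` applies. If `ε ≤ σ²`, then
    -- `√ε / σ ≤ 1` and what remains is `√(ε |ln ε|)`.
    rcases le_total (σ ^ 2) (ε σ) with h5 | h5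
    · have h6 := Real.log_le_log (pow_pos h2.1 2) h5
      rw [Real.log_pow] at h6
      have h7 : √(-Real.log (ε σ)) ≤ √2 * √|Real.log σ| := by
        rw [← Real.sqrt_mul zero_le_two]
        refine Real.sqrt_le_sqrt ?_
        have := neg_le_abs (Real.log σ)
        push_cast at h6
        linarith
      have h8 : ε σ * √(-Real.log (ε σ)) / σ ≤ √2 * (ε σ * √|Real.log σ| / σ) := by
        rw [mul_div_assoc', div_le_div_iff_of_pos_right h2.1]
        nlinarith
      have := Real.sqrt_nonneg (-(ε σ * Real.log (ε σ)))
      linarith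
    · have h6 : √(ε σ) ≤ σ :=
        (Real.sqrt_le_sqrt h5).trans_eq (Real.sqrt_sq h2.1.le)
      have h7 : ε σ * √(-Real.log (ε σ)) / σ ≤ √(-(ε σ * Real.log (ε σ))) := by
        rw [← mul_neg, Real.sqrt_mul h1.le, div_le_iff₀ h2.1]
        have h9 := mul_le_mul_of_nonneg_left h6
          (mul_nonneg (Real.sqrt_nonneg (ε σ)) (Real.sqrt_nonneg (-Real.log (ε σ))))
        calc ε σ * √(-Real.log (ε σ)) = √(ε σ) * √(-Real.log (ε σ)) * √(ε σ) := by
              rw [mul_right_comm, Real.mul_self_sqrt h1.le]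
          _ ≤ _ := h9
      have h8 : 0 ≤ √2 * (ε σ * √|Real.log σ| / σ) := by
        have := h2.1
        positivity
      linarith

/-- The threshold for the increments of the noise, which are exceeded with small probability. -/
def oscThreshold (e : ℝ) : ℝ := 2 * √e * √(-Real.log e)

lemma oscThreshold_nonneg (e : ℝ) : 0 ≤ oscThreshold e := by
  unfold oscThreshold; positivity

lemma noise_oscThreshold {e σ : ℝ} (he : 0 < e) :
    σ / √e * (3 * oscThreshold e) = 6 * (σ * √(-Real.log e)) := by
  have : √e ≠ 0 := (Real.sqrt_pos.2 he).ne'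
  unfold oscThreshold
  field_simp
  ring

/-- With this threshold a block fails with probability at most `4 ε²`, and there are at most `T/ε +
1` blocks. -/
lemma tendsto_irregularBound (T : ℝ) (hε : ∀ᶠ σ in 𝓝[>] (0 : ℝ), 0 < ε σ)
    (hε0 : Tendsto ε (𝓝[>] 0) (𝓝 0)) :
    Tendsto (fun σ => irregularBound (ε σ) T (oscThreshold (ε σ))) (𝓝[>] 0) (𝓝 0) := by
  have h1 : Tendsto (fun σ => 4 * (T * ε σ + ε σ ^ 2)) (𝓝[>] 0) (𝓝 0) := by
    have := ((hε0.const_mul T).add (hε0.pow 2)).const_mul 4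
    simpa using this
  refine h1.congr' ?_
  filter_upwards [hε, hε0.eventually (ge_mem_nhds one_pos)] with σ h2 h3
  have hL : 0 ≤ -Real.log (ε σ) := neg_nonneg.2 (Real.log_nonpos h2.le h3)
  have h4 : -oscThreshold (ε σ) ^ 2 / (2 * ε σ) = Real.log (ε σ) + Real.log (ε σ) := by
    unfold oscThreshold
    rw [mul_pow, mul_pow, Real.sq_sqrt h2.le, Real.sq_sqrt hL]
    field_simp
    ring
  rw [irregularBound, h4, Real.exp_add, Real.exp_log h2]
  field_simp

end

/-! ### The two limits for the middle particle -/

section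

variable {U : ℝ → ℝ} {a b a₀ u₀ : ℝ} {ε : ℝ → ℝ} {Ω : ℝ → Type*} [∀ σ, MeasurableSpace (Ω σ)]
  {P : ∀ σ, Measure (Ω σ)} {W X : ∀ σ, ℝ≥0 → Ω σ → ℝ}

lemma eventually_noise_lt {κ u : ℝ} (hκ : 0 < κ) (hε0 : Tendsto ε (𝓝[>] 0) (𝓝 0))
    (hn : Tendsto (fun σ => σ * √(-Real.log (ε σ))) (𝓝[>] 0) (𝓝 0)) (a : ℝ) :
    ∀ᶠ σ in 𝓝[>] (0 : ℝ), 6 * (σ * √(-Real.log (ε σ))) +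
      (6 * (σ * √(-Real.log (ε σ))) + a * ε σ) / (2 * u) < κ := by
  have h := (hn.const_mul 6).add (((hn.const_mul 6).add (hε0.const_mul a)).div_const (2 * u))
  simp only [mul_zero, add_zero, zero_div] at h
  exact h.eventually (gt_mem_nhds hκ)

theorem tendsto_breaksLeft_of_fastStretching (hU : IsChainPotential U a b a₀ u₀)
    (hε : ∀ᶠ σ in 𝓝[>] (0 : ℝ), 0 < ε σ)
    (hX : ∀ᶠ σ in 𝓝[>] (0 : ℝ), SolvesChainSDE (P σ) U a b (ε σ) σ (W σ) (X σ))
    (h : FastStretching ε) :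
    Tendsto (fun σ => (P σ).real (breaksLeft a b (X σ))) (𝓝[>] 0) (𝓝 0) := by
  obtain ⟨κ, hκ, M, hM, g, hg, hgU⟩ := exists_regularized_force hU
  have ha := hU.a_pos
  have hT0 : 0 < b / a - 1 := by
    rw [sub_pos, lt_div_iff₀ ha]; linarith [hU.a_lt_b]
  have hT : ((b / a - 1).toNNReal : ℝ) = b / a - 1 := Real.coe_toNNReal _ hT0.le
  have hε0 := h.tendsto_zero
  have hq := h.tendsto_noise hε
  have hn : Tendsto (fun σ => σ * √(-Real.log (ε σ))) (𝓝[>] 0) (𝓝 0) := by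
    have h1 := hq.mul hε0
    rw [mul_zero] at h1
    refine h1.congr' ?_
    filter_upwards [hε] with σ h2
    rw [div_mul_cancel₀ _ h2.ne']
  have hsep : ∀ᶠ σ in 𝓝[>] (0 : ℝ), 6 * (σ * √(-Real.log (ε σ))) +
      6 * (σ * √(-Real.log (ε σ))) / (2 * u₀) < a * (b / a - 1 - ε σ / (2 * M)) := by
    have h1 := (hn.const_mul 6).add ((hn.const_mul 6).div_const (2 * u₀))
    have h2 := ((tendsto_const_nhds (x := b / a - 1)).sub (hε0.div_const (2 * M))).const_mul a
    simp only [mul_zero, add_zero, zero_div, sub_zero] at h1 h2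
    exact h1.eventually_lt h2 (mul_pos ha hT0)
  refine squeeze_zero' (Eventually.of_forall fun _ => measureReal_nonneg) ?_
    (tendsto_irregularBound (b / a - 1) hε hε0)
  filter_upwards [hε, hX, eventually_noise_lt (u := u₀) hκ hε0 hn a, hsep, self_mem_nhdsWithin,
    -- The scaled oscillation bound is `6 σ |ln ε|^{1/2}`; the constants `a/12` and `a/(48M)` are
    -- the two requirements of the small-noise lemma divided by `6`.
    hq.eventually (gt_mem_nhds (show 0 < a / 12 by positivity)),
    hq.eventually (gt_mem_nhds (show 0 < a / (48 * M) by positivity))]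
    with σ hε hX hκ hsep hσ hr₁ hr₂
  have hr := noise_oscThreshold (σ := σ) hε
  rw [div_lt_iff₀ hε] at hr₁ hr₂
  rw [← hT]
  refine measureReal_breaksLeft_le_irregularBound hU hM hg hgU hT hε hσ (oscThreshold_nonneg _) hX
    ?_ ?_ ?_ ?_ <;> rw [hr]
  · exact hκ
  · linarith
  · have : a * ε σ / (4 * (2 * M)) = 6 * (a / (48 * M) * ε σ) := by field_simp; norm_num
    linarith
  · rwa [hT]

theorem tendsto_breaksLeft_of_slowStretching (hU : IsChainPotential U a b a₀ u₀)
    (hε : ∀ᶠ σ in 𝓝[>] (0 : ℝ), 0 < ε σ)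
    (hX : ∀ᶠ σ in 𝓝[>] (0 : ℝ), SolvesChainSDE (P σ) U a b (ε σ) σ (W σ) (X σ))
    (h : SlowStretching ε) :
    Tendsto (fun σ => (P σ).real (breaksLeft a b (X σ))) (𝓝[>] 0) (𝓝 (1 / 2)) := by
  obtain ⟨κ, hκ, M, hM, g, hg, hgU⟩ := exists_regularized_force hU
  have ha := hU.a_pos
  have hu₀ := hU.u₀_pos
  have hT0 : 0 < b / a - 1 := by
    rw [sub_pos, lt_div_iff₀ ha]; linarith [hU.a_lt_b]
  have hT : ((b / a - 1).toNNReal : ℝ) = b / a - 1 := Real.coe_toNNReal _ hT0.le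
  have hε0 := h.tendsto_zero hε
  have hn := h.tendsto_noise hε
  have hq := h.tendsto_ratio hε
  have hB := tendsto_irregularBound (b / a - 1) hε hε0
  -- The final interval has length `K n`. Its cone width `a K n` is twice the noise amplitude `6 n
  -- (1 + 1/(2u₀))`, and the spare half absorbs the `ε`-terms, collected in `C` below, since
  -- eventually `ε C < 6 n`.
  set K : ℝ := 12 * (1 + 1 / (2 * u₀)) / a with hK
  have hK0 : 0 < K := by positivity
  have haK : a * K = 12 + 12 * (1 / (2 * u₀)) := by rw [hK]; field_simp
  have hshift : Tendsto (fun σ =>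
      gaussianShiftDist (4 * a * √(K * (ε σ * √(-Real.log (ε σ)) / σ)))) (𝓝[>] 0) (𝓝 0) := by
    refine tendsto_gaussianShiftDist.comp ?_
    simpa using ((hq.const_mul K).sqrt).const_mul (4 * a)
  have hlow : Tendsto (fun σ => 1 / 2 - 2 * irregularBound (ε σ) (b / a - 1) (oscThreshold (ε σ)) -
      gaussianShiftDist (4 * a * √(K * (ε σ * √(-Real.log (ε σ)) / σ)))) (𝓝[>] 0)
      (𝓝 (1 / 2)) := by
    have h1 := ((hB.const_mul 2).const_sub (1 / 2)).sub hshift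
    rwa [mul_zero, sub_zero, sub_zero] at h1
  have hupp : Tendsto (fun σ => 1 / 2 + irregularBound (ε σ) (b / a - 1) (oscThreshold (ε σ)))
      (𝓝[>] 0) (𝓝 (1 / 2)) := by
    have h1 := hB.const_add (1 / 2)
    rwa [add_zero] at h1
  refine tendsto_of_tendsto_of_tendsto_of_le_of_le' hlow hupp ?_ ?_
  · set C : ℝ := a / u₀ + a * (2 / (2 * u₀) + 1 / (2 * M)) with hC
    have hC0 : 0 < C := by positivity
    have hδ := (hn.const_mul K).eventually (gt_mem_nhds (show K * 0 < b / a - 1 by rwa [mul_zero]))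
    filter_upwards [hε, hX, eventually_noise_lt (u := u₀) hκ hε0 hn a, self_mem_nhdsWithin, hδ,
      (hε0.eventually (gt_mem_nhds (Real.exp_pos (-1)))),
      hq.eventually (gt_mem_nhds (show 0 < 6 / C by positivity))]
      with σ hε hX hκ hσ hδ hL hCq
    have hσ : 0 < σ := hσ
    have hr := noise_oscThreshold (σ := σ) hε
    have hlog := Real.log_lt_log hε hL
    rw [Real.log_exp] at hlog
    have hL1 : 1 ≤ √(-Real.log (ε σ)) := Real.one_le_sqrt.2 (by linarith)
    set n := σ * √(-Real.log (ε σ)) with hn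
    have hn0 : 0 < n := mul_pos hσ (by linarith)
    rw [lt_div_iff₀ hC0, div_mul_eq_mul_div, div_lt_iff₀ hσ] at hCq
    have hCn : ε σ * C < 6 * n := by nlinarith [mul_pos hε hC0]
    have ht₀ : ((b / a - 1 - K * n).toNNReal : ℝ) = b / a - 1 - K * n :=
      Real.coe_toNNReal _ (by linarith)
    have hlt : (b / a - 1 - K * n).toNNReal < (b / a - 1).toNNReal := by
      rw [← NNReal.coe_lt_coe, ht₀, hT]
      linarith [mul_pos hK0 hn0]
    have key := le_measureReal_breaksLeft hU hM hg hgU hT hε hσ (oscThreshold_nonneg (ε σ)) hX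
      (by rwa [hr]) hlt ?_
    · rw [hT, ht₀, sub_sub_cancel] at key
      refine le_trans (le_of_eq ?_) key
      congr 2
      -- Rewrites the size of the Gaussian translation, `4a (√ε/σ) √(K n)`, in terms of the ratio
      -- that tends to zero.
      have h1 : K * (ε σ * √(-Real.log (ε σ)) / σ) = ε σ * (K * n) / σ ^ 2 := by
        rw [hn]; field_simp
      rw [h1, Real.sqrt_div (by positivity), Real.sqrt_sq hσ.le, Real.sqrt_mul hε.le]
      have := (Real.sqrt_pos.2 hε).ne'
      field_simp
    · rw [hr, hT, ht₀, sub_sub_cancel, ← mul_assoc a K, haK]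
      have h1 : 6 * n + (6 * n + 2 * a * ε σ) / (2 * u₀) +
          a * (ε σ * (2 / (2 * u₀) + 1 / (2 * M))) =
          6 * n + 6 * n * (1 / (2 * u₀)) + ε σ * C := by
        rw [hC]; field_simp; ring
      have h2 : 0 < n * (1 / (2 * u₀)) := by positivity
      linarith
  · filter_upwards [hε, hX, eventually_noise_lt (u := u₀) hκ hε0 hn a, self_mem_nhdsWithin]
      with σ hε hX hκ hσ
    have hr := noise_oscThreshold (σ := σ) hε
    rw [← hT]
    exact measureReal_breaksLeft_le hU hM hg hgU hT hε hσ (oscThreshold_nonneg _) hX (by rwa [hr])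

end

end BreakingChain

end

theorem theorem1
    (U : ℝ → ℝ) (a b a₀ u₀ : ℝ) (hU : BreakingChain.IsChainPotential U a b a₀ u₀)
    (ε : ℝ → ℝ) (hε : ∀ᶠ σ in 𝓝[>] (0 : ℝ), 0 < ε σ)
    (Ω : ℝ → Type*) [∀ σ, MeasurableSpace (Ω σ)] (P : ∀ σ, Measure (Ω σ))
    (W : ∀ σ, ℝ≥0 → Ω σ → ℝ) :
    -- the middle particle
    (∀ X : ∀ σ, ℝ≥0 → Ω σ → ℝ,
      (∀ᶠ σ in 𝓝[>] (0 : ℝ),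
        BreakingChain.SolvesChainSDE (P σ) U a b (ε σ) σ (W σ) (X σ)) →
      (BreakingChain.FastStretching ε →
        Tendsto (fun σ => (P σ).real (BreakingChain.breaksLeft a b (X σ)))
          (𝓝[>] 0) (𝓝 0)) ∧
      (BreakingChain.SlowStretching ε →
        Tendsto (fun σ => (P σ).real (BreakingChain.breaksLeft a b (X σ)))
          (𝓝[>] 0) (𝓝 (1 / 2)))) ∧
    -- the deviation process
    (∀ (V : ℝ → ℝ) (xdet : ℝ → ℝ → ℝ) (Y : ∀ σ, ℝ≥0 → Ω σ → ℝ),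
      BreakingChain.IsConvexExtension V U b a₀ →
      (∀ᶠ σ in 𝓝[>] (0 : ℝ), BreakingChain.SolvesDeterministic V a b (ε σ) (xdet σ)) →
      (∀ᶠ σ in 𝓝[>] (0 : ℝ),
        BreakingChain.SolvesDeviationSDE (P σ) V a b (ε σ) σ (xdet σ) (W σ) (Y σ)) →
      (BreakingChain.FastStretching ε →
        Tendsto (fun σ => (P σ).real (BreakingChain.deviationExitsAbove a b (xdet σ) (Y σ)))
          (𝓝[>] 0) (𝓝 0)) ∧
      (BreakingChain.SlowStretching ε →
        Tendsto (fun σ => (P σ).real (BreakingChain.deviationExitsAbove a b (xdet σ) (Y σ)))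
          (𝓝[>] 0) (𝓝 (1 / 2)))) := by
  refine ⟨fun X hX => ⟨fun h => BreakingChain.tendsto_breaksLeft_of_fastStretching hU hε hX h,
    fun h => BreakingChain.tendsto_breaksLeft_of_slowStretching hU hε hX h⟩,
    fun V xdet Y hV hxdet hY => ?_⟩
  have hX : ∀ᶠ σ in 𝓝[>] (0 : ℝ), BreakingChain.SolvesChainSDE (P σ) U a b (ε σ) σ (W σ)
      (BreakingChain.position a b (xdet σ) (Y σ)) := by
    filter_upwards [hxdet, hY] with σ h₁ h₂ using h₂.solvesChainSDE hU hV h₁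
  simp only [← BreakingChain.breaksLeft_position hU.a_pos hU.a_lt_b]
  exact ⟨fun h => BreakingChain.tendsto_breaksLeft_of_fastStretching hU hε hX h,
    fun h => BreakingChain.tendsto_breaksLeft_of_slowStretching hU hε hX h⟩
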